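/- Rings are commutative with $1$. For a space $X$ whose quasi-compact open sets are closed under finite intersections (including $X$ itself), let $C(X)_{cpt}$ be the bounded distributive lattice of its quasi-compact open sets, regarded as an idealic semiring with idempotent multiplication: the sum is $\cup$, the product is $\cap$, the order is inclusion, $1=X$, $0=\emptyset$. (Passing to complements, these are the compact elements of the lattice of closed sets ordered by reverse inclusion.) Homomorphisms of such semirings are homomorphisms of bounded lattices. **The algebraic type $\mathcal A$ of rings.** For a ring $R$ put $\alpha_1(R)=C(\mathrm{Spec}\,R)_{cpt}$ (finitely generated ideals of $R$ up to radical); a ring homomorphism $\varphi:B\to A$ acts by $\alpha_1(\varphi)\colon D(b_1,\dots,b_n)\mapsto D(\varphi(b_1),\dots,\varphi(b_n))$. Let $\alpha_2:R\to\alpha_1(R)$, $a\mapsto D(a)$. **$\mathcal A$-schemes.** An algebraic sober space is a spectral space: a quasi-compact sober space whose quasi-compact open sets form a basis closed under finite intersections. For such an $X$ let $\tau'_X$ be the sheaf $Z\mapsto C(Z)_{cpt}$ on $C(X)_{cpt}$, with restriction maps $A\mapsto A\cap W$ for $W\subseteq Z$. Sheaves on $C(X)_{cpt}$ are sheaves for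 finite covers. An $\mathcal A$-scheme is a triple $(X,\mathcal O_X,\beta_X)$, where 1. $X$ is an algebraic sober space; 2. $\mathcal O_X$ is a sheaf of rings on $C(X)_{cpt}$; 3. $\beta_X:\alpha_1\mathcal O_X\to\tau'_X$ is a morphism of sheaves of bounded distributive lattices, where $\alpha_1\mathcal O_X$ is the sheafification of $Z\mapsto\alpha_1(\mathcal O_X(Z))$; 4. restriction maps reflect localization: if $W\le Z$ in $C(X)_{cpt}$ and $a\in\mathcal O_X(Z)$ satisfies $W\le\beta_X(\alpha_2(a))$, then $\mathcal O_X(Z)\to\mathcal O_X(W)$ factors through $\mathcal O_X(Z)\to\mathcal O_X(Z)_a$. A morphism $(X,\mathcal O_X,\beta_X)\to(Y,\mathcal O_Y,\beta_Y)$ is a pair $(f,f^\#)$ of a quasi-compact continuous map $f:X\to Y$ (inverse images of quasi-compact open sets are quasi-compact) and a morphism $f^\#:\mathcal O_Y\to f_*\mathcal O_X$ of sheaves of rings such that $f_*\beta_X\circ\alpha_1(f^\#)=f^{-1}\circ\beta_Y$ as maps $\alpha_1\mathcal O_Y\to f_*\tau'_X$, where $f^{-1}:\tau'_Y\to f_*\tau'_X$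 is $A\mapsto f^{-1}(A)$. These form the category $\mathcal A\text{-}\mathbf{Sch}$. **The functor $\mathrm{Spec}^{\mathcal A}:\mathbf{Rng}^{op}\to\mathcal A\text{-}\mathbf{Sch}$.** For a ring $R$ let $X$ be the space of prime elements of the complete semiring $\alpha_1(R)^\dagger$ of order ideals of the lattice $\alpha_1(R)$ (with product $\cap$), with closed sets $V(\mathfrak a)=\{\mathfrak p\mid\mathfrak a\le\mathfrak p\}$; then $\alpha_1(R)\cong C(X)_{cpt}$ canonically. For $Z\in C(X)_{cpt}$ let $R_Z$ be the localization of $R$ at $\{x\in R\mid\alpha_2(x)\ge Z\}$. The structure sheaf $\mathcal O_X$ is the sheafification of $Z\mapsto R_Z$, and $\beta_X$ is the unique morphism whose composite with $\alpha_1(R)\to\alpha_1(R_Z)\to\alpha_1(\mathcal O_X(Z))$ is $\alpha_1(R)\cong C(X)_{cpt}\to C(Z)_{cpt}$, $K\mapsto K\cap Z$, for all $Z$. A ring homomorphism $\varphi:B\to A$ induces $\mathrm{Spec}^{\mathcal A}A\to\mathrm{Spec}^{\mathcal A}B$ by $\mathfrak p\mapsto\alpha_1(\varphi)^{-1}(\mathfrak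 p)$ on points and by the sheafification of $B_Z\to A_{f^{-1}(Z)}$ on structure sheaves. **Proposition.** Let $\mathbf{QSch}$ be the category of quasi-compact quasi-separated schemes and quasi-compact morphisms. There is a fully faithful functor $I:\mathbf{QSch}\to\mathcal A\text{-}\mathbf{Sch}$ such that $I\circ\mathrm{Spec}\cong\mathrm{Spec}^{\mathcal A}$, naturally, as functors $\mathbf{Rng}^{op}\to\mathcal A\text{-}\mathbf{Sch}$. -/

import Mathlib

open CategoryTheory TopologicalSpace Opposite

universe u

namespace ASch

/-! ### Conventions

A pre-complete idealic semiring with idempotent multiplication (without any requirement on the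
existence of infima) is the same thing as a bounded distributive lattice: addition is `⊔`,
multiplication is `⊓`, the multiplicative unit is `⊤` and zero is `⊥`. A homomorphism of such
semirings is a homomorphism of bounded lattices. So the category of these semirings is Mathlib's
category `BddDistLat`.

An algebraic sober space with quasi-compact continuous maps is Mathlib's `SpectralSpace` with
`SpectralMap`. The semiring `C(X)_cpt` of compact closed subsets of such a space `X` (closed sets
ordered by reverse inclusion, the sum being the intersection and the product being the union,
compact elements being the complements of quasi-compact open sets) is the lattice
`CompactOpens X` of quasi-compact open sets, by passage to complements. -/

/-! ### Distributive lattices of quasi-compact open sets -/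

section CompactOpens

variable {X Y Z : Type u} [TopologicalSpace X] [TopologicalSpace Y] [TopologicalSpace Z]

instance instDistribLattice [QuasiSeparatedSpace X] : DistribLattice (CompactOpens X) where
  __ := (inferInstance : SemilatticeSup (CompactOpens X))
  __ := (inferInstance : SemilatticeInf (CompactOpens X))
  le_sup_inf a b c := fun x hx => by
    have h : x ∈ ((a : Set X) ∪ b) ∩ (a ∪ c) := hx
    rw [← Set.union_inter_distrib_left] at h
    exact h

instance instDistribLatticeIic {L : Type u} [DistribLattice L] (a : L) :
    DistribLattice (Set.Iic a) where
  __ := (inferInstance : Lattice (Set.Iic a))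
  le_sup_inf x y z := le_sup_inf (x := x.1) (y := y.1) (z := z.1)

/-- Inverse image of quasi-compact open sets along a quasi-compact continuous map. -/
def pre [QuasiSeparatedSpace X] [CompactSpace X] [QuasiSeparatedSpace Y] [CompactSpace Y]
    (f : SpectralMap X Y) : BoundedLatticeHom (CompactOpens Y) (CompactOpens X) where
  toFun V := ⟨⟨f ⁻¹' V, V.isCompact.preimage_of_isOpen f.spectral' V.isOpen⟩,
    V.isOpen.preimage f.spectral'.continuous⟩
  map_sup' _ _ := rfl
  map_inf' _ _ := rfl
  map_top' := rfl
  map_bot' := rfl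

lemma mem_pre [QuasiSeparatedSpace X] [CompactSpace X] [QuasiSeparatedSpace Y] [CompactSpace Y]
    (f : SpectralMap X Y) (V : CompactOpens Y) (x : X) : x ∈ pre f V ↔ f x ∈ V := Iff.rfl

/-- The inverse image of quasi-compact open sets, as a functor of posets. -/
abbrev preFunctor [QuasiSeparatedSpace X] [CompactSpace X] [QuasiSeparatedSpace Y] [CompactSpace Y]
    (f : SpectralMap X Y) : CompactOpens Y ⥤ CompactOpens X :=
  (OrderHomClass.mono (pre f)).functor

variable (X) in
/-- The topology on the poset of quasi-compact open subsets of `X`: a sieve covers `U` when its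
members cover the set `U`. Since `U` is quasi-compact, finitely many members are then enough
(see `mem_cptTopology_iff`), so that the sheaves are the presheaves with the gluing property for
finite covers. -/
def cptTopology [QuasiSeparatedSpace X] : GrothendieckTopology (CompactOpens X) where
  sieves U := {S | ∀ x ∈ U, ∃ (V : CompactOpens X) (f : V ⟶ U), S f ∧ x ∈ V}
  top_mem' _ _ hx := ⟨_, 𝟙 _, trivial, hx⟩
  pullback_stable' U V S f hf y hy := by
    rcases hf y (f.le hy) with ⟨W, g, hg, hW⟩
    refine ⟨W ⊓ V, homOfLE inf_le_right, ?_, ?_⟩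
    · apply S.downward_closed hg (homOfLE inf_le_left)
    · exact ⟨hW, hy⟩
  transitive' U S hS R hR x hx := by
    rcases hS x hx with ⟨V, f, hf, hV⟩
    rcases hR hf _ hV with ⟨W, g, hg, hW⟩
    exact ⟨_, g ≫ f, hg, hW⟩

variable (X) in
/-- The sheaf `τ'` on `X`: it sends `U` to the lattice of quasi-compact open subsets of `U`, that
is to the semiring `C(U)_cpt`, and its restriction maps intersect with the smaller open set. -/
def tau [QuasiSeparatedSpace X] [CompactSpace X] : (CompactOpens X)ᵒᵖ ⥤ BddDistLat.{u} where
  obj U := BddDistLat.of (Set.Iic U.unop)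
  map {U V} i := BddDistLat.ofHom
    { toFun := fun W => ⟨W.1 ⊓ V.unop, Set.mem_Iic.mpr inf_le_right⟩
      map_sup' := fun a b => Subtype.ext (inf_sup_right _ _ _)
      map_inf' := fun a b => Subtype.ext (inf_inf_distrib_right _ _ _)
      map_top' := Subtype.ext (inf_eq_right.mpr i.unop.le)
      map_bot' := Subtype.ext (bot_inf_eq _) }
  map_id U := BddDistLat.ext fun W =>
    Subtype.ext (inf_eq_left.mpr (Set.mem_Iic.mp W.2))
  map_comp {U V W} i j := BddDistLat.ext fun A => Subtype.ext <| by
    change A.1 ⊓ W.unop = (A.1 ⊓ V.unop) ⊓ W.unop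
    rw [inf_assoc, inf_eq_right.mpr j.unop.le]

end CompactOpens

/-! ### The ring type: commutative rings with their finitely generated ideals up to radical -/

lemma isSpectralMap_comap {R S : Type u} [CommRing R] [CommRing S] (φ : R →+* S) :
    IsSpectralMap (PrimeSpectrum.comap φ) :=
  ⟨PrimeSpectrum.continuous_comap φ, fun K hK hK' => by
    classical
    obtain ⟨s, rfl⟩ := PrimeSpectrum.isCompact_isOpen_iff.mp ⟨hK', hK⟩
    refine (PrimeSpectrum.isCompact_isOpen_iff.mpr ⟨s.image φ, ?_⟩).1
    ext x; simp [PrimeSpectrum.mem_zeroLocus, Set.subset_def]⟩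

/-- The functor `α₁` from commutative rings to bounded distributive lattices,
`α₁(R) = C(Spec R)_cpt`: its elements are the quasi-compact open sets of `Spec R`, which are
the sets `D(a₁, …, aₙ)`, one for each finitely generated ideal up to radical. A homomorphism acts
by inverse image along `Spec`, i.e. by `D(a₁, …, aₙ) ↦ D(φ a₁, …, φ aₙ)`. -/
def alpha1 : CommRingCat.{u} ⥤ BddDistLat.{u} where
  obj R := BddDistLat.of (CompactOpens (PrimeSpectrum R))
  map {R S} φ := BddDistLat.ofHom (pre ⟨PrimeSpectrum.comap φ.hom, isSpectralMap_comap φ.hom⟩)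
  map_id R := by ext K; rfl
  map_comp φ ψ := by ext K; rfl

/-- The map `α₂ : R → α₁(R)` which sends an element `a` to the class `D(a)` of the ideal `(a)`. -/
def alpha2 {R : Type u} [CommRing R] (a : R) : CompactOpens (PrimeSpectrum R) :=
  ⟨⟨PrimeSpectrum.basicOpen a, PrimeSpectrum.isCompact_basicOpen a⟩,
    (PrimeSpectrum.basicOpen a).isOpen⟩

lemma mem_alpha2 {R : Type u} [CommRing R] (a : R) (p : PrimeSpectrum R) :
    p ∈ alpha2 a ↔ a ∉ p.asIdeal := Iff.rfl

/-! ### The spectrum of a bounded distributive lattice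

The completion `L†` of the semiring `L` is the complete lattice of order ideals of `L`, with the
product of two ideals being their intersection `⊓`. The spectrum is the space of prime elements
of `L†`, with closed sets `V(a) = {p | a ≤ p}`. -/

section LatSpec

variable (L : Type u) [DistribLattice L] [BoundedOrder L]

/-- A point of the spectrum: a prime element `p` of the complete semiring of order ideals,
i.e. `1 ≰ p`, and `a ≰ p` and `b ≰ p` imply `a b ≰ p`. -/
structure LatSpec where
  asIdeal : Order.Ideal L
  not_top_le : ¬ ⊤ ≤ asIdeal
  mul_not_le : ∀ a b : Order.Ideal L, ¬ a ≤ asIdeal → ¬ b ≤ asIdeal → ¬ a ⊓ b ≤ asIdeal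

namespace LatSpec

variable {L}

/-- The closed set `V(a)`. -/
def V (a : Order.Ideal L) : Set (LatSpec L) := {p | a ≤ p.asIdeal}

lemma mem_V {a : Order.Ideal L} {p : LatSpec L} : p ∈ V a ↔ a ≤ p.asIdeal := Iff.rfl

/-- The topology with closed sets `V(a)`, for `a` an order ideal. -/
instance : TopologicalSpace (LatSpec L) :=
  TopologicalSpace.ofClosed {Z | ∃ a, Z = V a}
    ⟨⊤, by ext p; simpa [V] using fun h => p.not_top_le h.ge⟩
    (fun A hA => ⟨sSup {a | V a ∈ A}, by
      ext p
      simp only [Set.mem_sInter, V, Set.mem_ofPred_eq, sSup_le_iff]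
      refine ⟨fun h a ha => h _ ha, fun h Z hZ => ?_⟩
      obtain ⟨a, rfl⟩ := hA hZ
      exact h a hZ⟩)
    (by
      rintro _ ⟨a, rfl⟩ _ ⟨b, rfl⟩
      refine ⟨a ⊓ b, ?_⟩
      ext p
      constructor
      · rintro (h | h)
        · exact mem_V.mpr (inf_le_left.trans (mem_V.mp h))
        · exact mem_V.mpr (inf_le_right.trans (mem_V.mp h))
      · intro h
        by_contra hc
        rw [Set.mem_union, not_or] at hc
        exact p.mul_not_le a b hc.1 hc.2 h)

lemma isClosed_iff {Z : Set (LatSpec L)} : IsClosed Z ↔ ∃ a, Z = V a := by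
  rw [← isOpen_compl_iff]
  change Zᶜᶜ ∈ {Z | ∃ a, Z = V a} ↔ _
  rw [compl_compl]; rfl

lemma top_notMem (p : LatSpec L) : ⊤ ∉ p.asIdeal :=
  fun h => p.not_top_le fun _ _ => p.asIdeal.lower le_top h

lemma mem_or_mem (p : LatSpec L) {x y : L} (h : x ⊓ y ∈ p.asIdeal) :
    x ∈ p.asIdeal ∨ y ∈ p.asIdeal := by
  by_contra! hc
  refine p.mul_not_le (.principal x) (.principal y) ?_ ?_ ?_
  · simpa using hc.1
  · simpa using hc.2
  · intro z hz
    rw [Order.Ideal.mem_inf, Order.Ideal.mem_principal, Order.Ideal.mem_principal] at hz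
    exact p.asIdeal.lower (le_inf hz.1 hz.2) h

/-- The point given by a prime ideal of the lattice. -/
def mk' (p : Order.Ideal L) (h1 : ⊤ ∉ p) (h2 : ∀ x y, x ⊓ y ∈ p → x ∈ p ∨ y ∈ p) : LatSpec L where
  asIdeal := p
  not_top_le h := h1 (h trivial)
  mul_not_le a b ha hb h := by
    obtain ⟨x, hx, hx'⟩ := SetLike.not_le_iff_exists.mp ha
    obtain ⟨y, hy, hy'⟩ := SetLike.not_le_iff_exists.mp hb
    have : x ⊓ y ∈ a ⊓ b := Order.Ideal.mem_inf.mpr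
      ⟨a.lower inf_le_left hx, b.lower inf_le_right hy⟩
    exact (h2 x y (h this)).elim hx' hy'

@[ext] lemma ext {p q : LatSpec L} (h : ∀ x, x ∈ p.asIdeal ↔ x ∈ q.asIdeal) : p = q := by
  cases p; cases q
  congr
  exact SetLike.ext h

/-- The complement of the closed set of the principal ideal of `l`. -/
def basicSet (l : L) : Set (LatSpec L) := {p | l ∉ p.asIdeal}

lemma isOpen_basicSet (l : L) : IsOpen (basicSet l) := by
  rw [← isClosed_compl_iff, isClosed_iff]
  exact ⟨.principal l, by ext p; simp [basicSet, V]⟩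

lemma basicSet_sup (l m : L) : basicSet (l ⊔ m) = basicSet l ∪ basicSet m := by
  ext p; simp only [basicSet, Set.mem_ofPred_eq, Order.Ideal.sup_mem_iff, Set.mem_union]; tauto

lemma basicSet_inf (l m : L) : basicSet (l ⊓ m) = basicSet l ∩ basicSet m := by
  ext p
  simp only [basicSet, Set.mem_ofPred_eq, Set.mem_inter_iff]
  refine ⟨fun h => ⟨fun h' => h (p.asIdeal.lower inf_le_left h'),
    fun h' => h (p.asIdeal.lower inf_le_right h')⟩, fun h h' => ?_⟩
  exact (p.mem_or_mem h').elim h.1 h.2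

lemma basicSet_top : basicSet (⊤ : L) = Set.univ := by
  ext p; simpa [basicSet] using p.top_notMem

lemma basicSet_bot : basicSet (⊥ : L) = ∅ := by
  ext p; simp [basicSet]

lemma exists_basicSet {U : Set (LatSpec L)} (hU : IsOpen U) {p : LatSpec L} (hp : p ∈ U) :
    ∃ l, p ∈ basicSet l ∧ basicSet l ⊆ U := by
  obtain ⟨a, ha⟩ := isClosed_iff.mp hU.isClosed_compl
  have hp' : ¬ a ≤ p.asIdeal := by
    intro h
    have : p ∈ Uᶜ := by rw [ha]; exact h
    exact this hp
  obtain ⟨l, hl, hl'⟩ := SetLike.not_le_iff_exists.mp hp'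
  refine ⟨l, hl', fun q hq => ?_⟩
  by_contra hc
  have : q ∈ V a := ha ▸ hc
  exact hq (this hl)

lemma isTopologicalBasis : IsTopologicalBasis (Set.range (basicSet (L := L))) :=
  isTopologicalBasis_of_isOpen_of_nhds (by rintro _ ⟨l, rfl⟩; exact isOpen_basicSet l)
    fun _ _ hp hU => by
      obtain ⟨l, h1, h2⟩ := exists_basicSet hU hp
      exact ⟨_, ⟨l, rfl⟩, h1, h2⟩

/-- The prime ideal theorem. -/
lemma exists_point (I : Order.Ideal L) {l : L} (hl : l ∉ I) :
    ∃ p : LatSpec L, I ≤ p.asIdeal ∧ l ∉ p.asIdeal := by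
  obtain ⟨J, hJ, hIJ, hd⟩ := DistribLattice.prime_ideal_of_disjoint_filter_ideal
    (F := Order.PFilter.principal l) (I := I) (by
      rw [Set.disjoint_left]
      intro x hx hx'
      exact hl (I.lower (Order.PFilter.mem_principal.mp hx) hx'))
  have hlJ : l ∉ J := Set.disjoint_left.mp hd (Order.PFilter.mem_principal.mpr le_rfl)
  exact ⟨mk' J (fun h => hlJ (J.lower le_top h)) (fun _ _ => hJ.mem_or_mem), hIJ, hlJ⟩

lemma isCompact_basicSet (l : L) : IsCompact (basicSet l) := by
  classical
  refine isCompact_of_finite_subcover fun {ι} U hU hc => ?_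
  let J : Order.Ideal L := Order.IsIdeal.toIdeal
    (I := {m | ∃ t : Finset ι, basicSet m ⊆ ⋃ i ∈ t, U i})
    { IsLowerSet := by
        rintro a b hba ⟨t, ht⟩
        exact ⟨t, fun p hp => ht fun h => hp (p.asIdeal.lower hba h)⟩
      Nonempty := ⟨⊥, ∅, by simp [basicSet_bot]⟩
      Directed := by
        rintro a ⟨t, ht⟩ b ⟨t', ht'⟩
        refine ⟨a ⊔ b, ⟨t ∪ t', ?_⟩, le_sup_left, le_sup_right⟩
        rw [basicSet_sup, Finset.set_biUnion_union]
        exact Set.union_subset_union ht ht' }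
  by_cases hl : l ∈ J
  · exact hl
  obtain ⟨p, hp, hlp⟩ := exists_point J hl
  obtain ⟨i, hi⟩ := Set.mem_iUnion.mp (hc hlp)
  obtain ⟨m, hm, hmU⟩ := exists_basicSet (hU i) hi
  exact absurd (hp (show m ∈ J from ⟨{i}, by simpa using hmU⟩)) hm

lemma isCompact_isOpen_iff {U : Set (LatSpec L)} :
    IsCompact U ∧ IsOpen U ↔ ∃ l, U = basicSet l := by
  constructor
  · intro h
    obtain ⟨s, hs, rfl⟩ := (isCompact_open_iff_eq_finite_iUnion_of_isTopologicalBasis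
      (basicSet (L := L)) isTopologicalBasis isCompact_basicSet U).mp h
    clear h
    induction s, hs using Set.Finite.induction_on with
    | empty => exact ⟨⊥, by simp [basicSet_bot]⟩
    | insert _ _ ih =>
      obtain ⟨l, hl⟩ := ih
      exact ⟨_ ⊔ l, by rw [Set.biUnion_insert, hl, basicSet_sup]⟩
  · rintro ⟨l, rfl⟩
    exact ⟨isCompact_basicSet l, isOpen_basicSet l⟩

instance : SpectralSpace (LatSpec L) where
  t0 p q h := by
    ext l
    rw [← not_iff_not]
    exact h.mem_open_iff (isOpen_basicSet l)
  isCompact_univ := basicSet_top (L := L) ▸ isCompact_basicSet ⊤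
  sober {S} hS hS' := by
    let I : Order.Ideal L := Order.IsIdeal.toIdeal (I := {m | S ∩ basicSet m = ∅})
      { IsLowerSet := by
          intro a b hba ha
          have hab : basicSet b ⊆ basicSet a := fun p hp h => hp (p.asIdeal.lower hba h)
          simp only [Set.mem_ofPred_eq] at ha ⊢
          exact Set.subset_eq_empty (Set.inter_subset_inter_right S hab) ha
        Nonempty := ⟨⊥, by simp [basicSet_bot]⟩
        Directed := by
          intro a ha b hb
          refine ⟨a ⊔ b, ?_, le_sup_left, le_sup_right⟩
          simp only [Set.mem_ofPred_eq] at ha hb ⊢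
          rw [basicSet_sup, Set.inter_union_distrib_left, ha, hb, Set.union_empty] }
    have hI : ∀ m, m ∈ I ↔ S ∩ basicSet m = ∅ := fun m => Iff.rfl
    let x : LatSpec L := mk' I
      (fun h => by
        rw [hI, basicSet_top, Set.inter_univ] at h
        exact hS.nonempty.ne_empty h)
      (fun a b h => by
        rw [hI] at h
        rw [hI, hI]
        by_contra! hc
        have := hS.isPreirreducible _ _ (isOpen_basicSet a) (isOpen_basicSet b) hc.1 hc.2
        rw [← basicSet_inf, h] at this
        exact Set.not_nonempty_empty this)
    refine ⟨x, ?_⟩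
    obtain ⟨a, rfl⟩ := isClosed_iff.mp hS'
    have hx : x ∈ V a := by
      intro m hm
      change m ∈ I
      rw [hI, Set.eq_empty_iff_forall_notMem]
      exact fun p hp => hp.2 (hp.1 hm)
    refine (isGenericPoint_iff_forall_closed hS' hx).mpr ?_
    intro Z hZ hxZ p hp
    obtain ⟨b, rfl⟩ := isClosed_iff.mp hZ
    intro m hm
    have : m ∈ I := hxZ hm
    rw [hI, Set.eq_empty_iff_forall_notMem] at this
    by_contra hc
    exact this p ⟨hp, hc⟩
  inter_isCompact := (QuasiSeparatedSpace.of_isTopologicalBasis isTopologicalBasis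
    fun i j => basicSet_inf i j ▸ isCompact_basicSet _).inter_isCompact
  isTopologicalBasis := (PrespectralSpace.of_isTopologicalBasis' isTopologicalBasis
    isCompact_basicSet).isTopologicalBasis

/-- The canonical map from `L` to the lattice `C(X)_cpt` of its spectrum `X`. -/
def basic (l : L) : CompactOpens (LatSpec L) :=
  ⟨⟨basicSet l, isCompact_basicSet l⟩, isOpen_basicSet l⟩

lemma mem_basic {l : L} {p : LatSpec L} : p ∈ basic l ↔ l ∉ p.asIdeal := Iff.rfl

/-- The map of spectra on points, `q ↦ {x | φ x ∈ q}`. -/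
def comapFun {M : Type u} [DistribLattice M] [BoundedOrder M]
    (φ : BoundedLatticeHom L M) (q : LatSpec M) : LatSpec L :=
  mk' (Order.IsIdeal.toIdeal (I := φ ⁻¹' q.asIdeal)
    { IsLowerSet := fun a b hba h => q.asIdeal.lower (OrderHomClass.mono φ hba) h
      Nonempty := ⟨⊥, by simp⟩
      Directed := fun a ha b hb => ⟨a ⊔ b, by
        simpa [Set.mem_preimage] using ⟨ha, hb⟩, le_sup_left, le_sup_right⟩ })
    (fun h => q.top_notMem (map_top φ ▸ (show φ ⊤ ∈ q.asIdeal from h)))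
    (fun x y h => q.mem_or_mem (x := φ x) (y := φ y) <| by
      rw [← map_inf φ]; exact h)

lemma mem_comapFun {M : Type u} [DistribLattice M] [BoundedOrder M]
    (φ : BoundedLatticeHom L M) (q : LatSpec M) (x : L) :
    x ∈ (comapFun φ q).asIdeal ↔ φ x ∈ q.asIdeal := Iff.rfl

/-- The map of spectra induced by a homomorphism of bounded distributive lattices. -/
def comap {M : Type u} [DistribLattice M] [BoundedOrder M]
    (φ : BoundedLatticeHom L M) : SpectralMap (LatSpec M) (LatSpec L) where
  toFun := comapFun φ
  spectral' :=
    { toContinuous := isTopologicalBasis.continuous_iff.mpr (by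
        rintro _ ⟨l, rfl⟩
        exact isOpen_basicSet (φ l))
      isCompact_preimage_of_isOpen := fun s hs hs' => by
        obtain ⟨l, rfl⟩ := isCompact_isOpen_iff.mp ⟨hs', hs⟩
        exact isCompact_basicSet (φ l) }

end LatSpec
end LatSpec
/-! ### Schemes for this ring type -/

section Sheaf
variable {X Y : Type u} [TopologicalSpace X] [TopologicalSpace Y]
variable [QuasiSeparatedSpace X] [CompactSpace X] [QuasiSeparatedSpace Y] [CompactSpace Y]

instance isContinuous_preFunctor (f : SpectralMap X Y) :
    (preFunctor f).IsContinuous (cptTopology Y) (cptTopology X) := by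
  refine Functor.isContinuous_of_coverPreserving ⟨?_⟩ ⟨?_⟩
  · intro F U T s hs V₁ V₂ W f₁ f₂ g₁ g₂ h₁ h₂ _
    have h := hs (homOfLE inf_le_left : V₁ ⊓ V₂ ⟶ V₁) (homOfLE inf_le_right : V₁ ⊓ V₂ ⟶ V₂)
      h₁ h₂ (Subsingleton.elim _ _)
    have i : W ⟶ (preFunctor f).obj (V₁ ⊓ V₂) := homOfLE (le_inf f₁.le f₂.le)
    have h' := congrArg (F.obj.map i.op) h
    simp only [Functor.comp_map, ← Functor.map_comp_apply] at h'
    exact h'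
  · intro U S hS x hx
    obtain ⟨V, g, hg, hV⟩ := hS (f x) hx
    exact ⟨_, (preFunctor f).map g, Sieve.image_mem_functorPushforward _ _ hg, hV⟩

lemma isSheaf_pushforward (f : SpectralMap X Y) {P : (CompactOpens X)ᵒᵖ ⥤ CommRingCat.{u}}
    (hP : Presheaf.IsSheaf (cptTopology X) P) :
    Presheaf.IsSheaf (cptTopology Y) ((preFunctor f).op ⋙ P) :=
  Functor.op_comp_isSheaf_of_isSheaf (preFunctor f) (cptTopology Y) (cptTopology X) P hP

/-- The morphism `τ'_Y ⟶ f_* τ'_X` which sends `W` to its inverse image `f⁻¹(W)`. -/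
def tauMap (f : SpectralMap X Y) : tau Y ⟶ (preFunctor f).op ⋙ tau X where
  app V := BddDistLat.ofHom
    { toFun := fun W => ⟨pre f W.1, Set.mem_Iic.mpr (OrderHomClass.mono (pre f) W.2)⟩
      map_sup' := fun a b => Subtype.ext (map_sup (pre f) _ _)
      map_inf' := fun a b => Subtype.ext (map_inf (pre f) _ _)
      map_top' := rfl
      map_bot' := Subtype.ext (map_bot (pre f)) }
  naturality U V i := rfl

lemma mem_cptTopology_iff {U : CompactOpens X} {S : Sieve U} :
    S ∈ cptTopology X U ↔ ∃ t : Finset (CompactOpens X),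
      (∀ V ∈ t, ∃ i : V ⟶ U, S i) ∧ (U : Set X) ⊆ ⋃ V ∈ t, (V : Set X) := by
  classical
  constructor
  · intro hS
    choose V i hi hV using hS
    obtain ⟨t, ht⟩ := U.isCompact.elim_finite_subcover
      (fun x : U => (V x.1 x.2 : Set X)) (fun x => (V x.1 x.2).isOpen)
      (fun x hx => Set.mem_iUnion.mpr ⟨⟨x, hx⟩, hV x hx⟩)
    refine ⟨t.image fun x => V x.1 x.2, ?_, ?_⟩
    · intro W hW
      obtain ⟨x, _, rfl⟩ := Finset.mem_image.mp hW
      exact ⟨_, hi x.1 x.2⟩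
    · intro y hy
      obtain ⟨x, hx, hyx⟩ := Set.mem_iUnion₂.mp (ht hy)
      exact Set.mem_iUnion₂.mpr ⟨_, Finset.mem_image_of_mem _ hx, hyx⟩
  · rintro ⟨t, ht, hc⟩ x hx
    obtain ⟨V, hV, hxV⟩ := Set.mem_iUnion₂.mp (hc hx)
    obtain ⟨i, hi⟩ := ht V hV
    exact ⟨V, i, hi, hxV⟩

/-- The gluing property of `τ'`. -/
lemma tau_existsUnique {U : CompactOpens X} {S : Sieve U} (hS : S ∈ cptTopology X U)
    (s : ∀ V : CompactOpens X, (V ⟶ U) → Set.Iic V)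
    (hs : ∀ (V W : CompactOpens X) (i : V ⟶ U) (j : W ⟶ U), S i → S j →
      (s V i).1 ⊓ W = (s W j).1 ⊓ V) :
    ∃! A : Set.Iic U, ∀ (V : CompactOpens X) (i : V ⟶ U), S i → A.1 ⊓ V = (s V i).1 := by
  classical
  choose V i hi hV using hS
  have key : ∀ {W W' : CompactOpens X} (j : W ⟶ U) (j' : W' ⟶ U), S j → S j' → ∀ x ∈ W',
      x ∈ (s W j).1 → x ∈ (s W' j').1 := fun {W W'} j j' hj hj' x hx hx' => by
    have h : x ∈ (s W j).1 ⊓ W' := ⟨hx', hx⟩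
    rw [hs W W' j j' hj hj'] at h
    exact h.1
  obtain ⟨t, ht⟩ := U.isCompact.elim_finite_subcover
    (fun x : U => (V x.1 x.2 : Set X)) (fun x => (V x.1 x.2).isOpen)
    (fun x hx => Set.mem_iUnion.mpr ⟨⟨x, hx⟩, hV x hx⟩)
  refine ⟨⟨t.sup fun x => (s _ (i x.1 x.2)).1, Set.mem_Iic.mpr (Finset.sup_le fun x _ =>
    (Set.mem_Iic.mp (s _ (i x.1 x.2)).2).trans (i x.1 x.2).le)⟩, ?_, ?_⟩
  · intro W j hj
    change (t.sup fun x => (s _ (i x.1 x.2)).1) ⊓ W = (s W j).1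
    apply le_antisymm
    · rw [Finset.sup_inf_distrib_right]
      exact Finset.sup_le fun x _ y hy => key _ j (hi x.1 x.2) hj y hy.2 hy.1
    · intro y hy
      have hyW : y ∈ W := Set.mem_Iic.mp (s W j).2 hy
      obtain ⟨x, hx, hyx⟩ := Set.mem_iUnion₂.mp (ht (j.le hyW))
      exact ⟨Finset.le_sup (f := fun x : U => (s _ (i x.1 x.2)).1) hx
        (key j _ hj (hi x.1 x.2) y hyx hy), hyW⟩
  · intro B hB
    apply Subtype.ext
    change B.1 = t.sup fun x => (s _ (i x.1 x.2)).1
    apply le_antisymm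
    · intro y hy
      obtain ⟨x, hx, hyx⟩ := Set.mem_iUnion₂.mp (ht (Set.mem_Iic.mp B.2 hy))
      refine Finset.le_sup (f := fun x : U => (s _ (i x.1 x.2)).1) hx ?_
      rw [← hB _ _ (hi x.1 x.2)]
      exact ⟨hy, hyx⟩
    · refine Finset.sup_le fun x _ => ?_
      rw [← hB _ _ (hi x.1 x.2)]
      exact inf_le_left

lemma ext_of_local {P : (CompactOpens X)ᵒᵖ ⥤ CommRingCat.{u}}
    (hP : Presheaf.IsSheaf (cptTopology X) P) {U : CompactOpens X} {s t : P.obj (op U)}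
    (h : ∀ x ∈ U, ∃ (V : CompactOpens X) (i : V ⟶ U), x ∈ V ∧ P.map i.op s = P.map i.op t) :
    s = t := by
  have hs := (isSheaf_iff_isSheaf_of_type _ _).mp
    ((Presheaf.isSheaf_iff_isSheaf_forget (cptTopology X) P (forget CommRingCat)).mp hP)
  let S : Sieve U :=
    { arrows := fun V i => P.map i.op s = P.map i.op t
      downward_closed := fun {V W} i hi j => by
        rw [op_comp, P.map_comp, ConcreteCategory.comp_apply, ConcreteCategory.comp_apply, hi] }
  have hS : S ∈ cptTopology X U := fun x hx => by
    obtain ⟨V, i, hx, hi⟩ := h x hx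
    exact ⟨V, i, hi, hx⟩
  exact (hs.isSeparated S hS).ext fun V i hi => hi

lemma isUnit_of_local {P : (CompactOpens X)ᵒᵖ ⥤ CommRingCat.{u}}
    (hP : Presheaf.IsSheaf (cptTopology X) P) {U : CompactOpens X} {s : P.obj (op U)}
    (h : ∀ x ∈ U, ∃ (V : CompactOpens X) (i : V ⟶ U), x ∈ V ∧ IsUnit (P.map i.op s)) :
    IsUnit s := by
  have hs := (isSheaf_iff_isSheaf_of_type _ _).mp
    ((Presheaf.isSheaf_iff_isSheaf_forget (cptTopology X) P (forget CommRingCat)).mp hP)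
  let S : Sieve U :=
    { arrows := fun V i => IsUnit (P.map i.op s)
      downward_closed := fun {V W} i hi j => by
        rw [op_comp, P.map_comp, ConcreteCategory.comp_apply]
        exact hi.map (P.map j.op).hom }
  have hS : S ∈ cptTopology X U := fun x hx => by
    obtain ⟨V, i, hx, hi⟩ := h x hx
    exact ⟨V, i, hi, hx⟩
  let fam : Presieve.FamilyOfElements (P ⋙ forget CommRingCat) S.arrows :=
    fun V i hi => ((IsUnit.unit hi)⁻¹ : (P.obj (op V))ˣ).1
  have hfam : ∀ {V} (i : V ⟶ U) (hi : S i), P.map i.op s * (fam i hi : P.obj (op V)) = 1 :=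
    fun i hi => IsUnit.mul_val_inv hi
  have hcomp : fam.Compatible := by
    rw [Presieve.compatible_iff_sieveCompatible]
    intro V W i j hi
    have hj := S.downward_closed hi j
    have h1 := hfam (j ≫ i) hj
    have h2 := congrArg (P.map j.op) (hfam i hi)
    rw [map_mul, map_one, ← ConcreteCategory.comp_apply, ← P.map_comp, ← op_comp] at h2
    exact (show IsUnit _ from hj).mul_left_cancel (h1.trans h2.symm)
  obtain ⟨t, ht, -⟩ := hs S hS fam hcomp
  refine IsUnit.of_mul_eq_one t ?_
  refine ext_of_local hP fun x hx => ?_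
  obtain ⟨V, i, hx, hi⟩ := h x hx
  refine ⟨V, i, hx, ?_⟩
  rw [map_mul, map_one]
  have := ht i hi
  exact (congrArg (P.map i.op s * ·) this).trans (hfam i hi)

end Sheaf

/-- An `𝒜`-scheme: an algebraic sober space `X`, a sheaf of commutative rings `𝒪_X` on its
quasi-compact open sets, and a morphism `β_X` from (the sheafification of) `α₁ 𝒪_X` to `τ'_X`, such
that the restriction maps reflect localization. As `τ'_X` is a sheaf (see `tau_existsUnique`),
a morphism out of the sheafification of the presheaf `U ↦ α₁(𝒪_X(U))` is the same thing as a
morphism out of this presheaf, and `β` is given in the latter form.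

Reflecting localization means: for `W ≤ Z` and `a ∈ 𝒪_X(Z)` such that `W` is contained in the open
set `β(α₂(a))`, the restriction map `𝒪_X(Z) → 𝒪_X(W)` factors through the localization
`𝒪_X(Z) → 𝒪_X(Z)_a`. -/
structure AScheme where
  carrier : Type u
  [topology : TopologicalSpace carrier]
  [spectral : SpectralSpace carrier]
  presheaf : (CompactOpens carrier)ᵒᵖ ⥤ CommRingCat.{u}
  isSheaf : Presheaf.IsSheaf (cptTopology carrier) presheaf
  β : presheaf ⋙ alpha1 ⟶ tau carrier
  reflects : ∀ ⦃Z W : CompactOpens carrier⦄ (h : W ≤ Z) (a : presheaf.obj (op Z)),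
    W ≤ ((β.app (op Z)).hom (alpha2 a)).1 →
      ∃ g : Localization.Away a →+* presheaf.obj (op W),
        g.comp (algebraMap _ _) = (presheaf.map (homOfLE h).op).hom

namespace AScheme
attribute [instance] topology spectral

/-- A morphism of `𝒜`-schemes: a quasi-compact continuous map `f` of the underlying spaces with a
morphism of sheaves `c : 𝒪_Y ⟶ f_* 𝒪_X` such that the square formed by `α₁(c)`, `β_Y`, `f_* β_X` and
the inverse image `τ'_Y ⟶ f_* τ'_X` commutes. -/
structure Hom (X Y : AScheme.{u}) where
  base : SpectralMap X.carrier Y.carrier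
  c : Y.presheaf ⟶ (preFunctor base).op ⋙ X.presheaf
  comm : Functor.whiskerRight c alpha1 ≫ Functor.whiskerLeft (preFunctor base).op X.β =
    Y.β ≫ tauMap base

lemma Hom.ext_heq {X Y : AScheme.{u}} {f g : Hom X Y} (h : f.base = g.base)
    (h' : HEq f.c g.c) : f = g := by
  obtain ⟨b, c, _⟩ := f
  obtain ⟨b', c', _⟩ := g
  obtain rfl : b = b' := h
  obtain rfl : c = c' := eq_of_heq h'
  exact rfl

/-- The identity morphism. -/
def Hom.id (X : AScheme.{u}) : Hom X X where
  base := SpectralMap.id X.carrier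
  c := 𝟙 X.presheaf
  comm := by
    ext V K
    apply Subtype.ext
    rfl

/-- The composite of two morphisms. -/
def Hom.comp {X Y Z : AScheme.{u}} (f : Hom X Y) (g : Hom Y Z) : Hom X Z where
  base := g.base.comp f.base
  c := g.c ≫ Functor.whiskerLeft (preFunctor g.base).op f.c
  comm := by
    apply NatTrans.ext
    funext V
    have h1 : alpha1.map (f.c.app (op (pre g.base V.unop))) ≫ X.β.app _ =
        Y.β.app _ ≫ (tauMap f.base).app _ :=
      NatTrans.congr_app f.comm (op (pre g.base V.unop))
    have h2 : alpha1.map (g.c.app V) ≫ Y.β.app _ = Z.β.app V ≫ (tauMap g.base).app V :=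
      NatTrans.congr_app g.comm V
    have h3 := (congrArg (alpha1.map (g.c.app V) ≫ ·) h1).trans
      ((Category.assoc _ _ _).symm.trans
        ((congrArg (· ≫ (tauMap f.base).app (op (pre g.base V.unop))) h2).trans
          (Category.assoc _ _ _)))
    exact (congrArg (· ≫ X.β.app _) (alpha1.map_comp _ _)).trans ((Category.assoc _ _ _).trans h3)

instance : Category AScheme.{u} where
  Hom := Hom
  id := Hom.id
  comp := Hom.comp
  id_comp f := Hom.ext_heq rfl
    (heq_of_eq (NatTrans.ext (funext fun _ => Category.comp_id _)))
  comp_id f := Hom.ext_heq rfl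
    (heq_of_eq (NatTrans.ext (funext fun _ => Category.id_comp _)))
  assoc f g h := Hom.ext_heq rfl
    (heq_of_eq (NatTrans.ext (funext fun _ => (Category.assoc _ _ _).symm)))

end AScheme
/-! ### Preparations for the spectrum of a ring -/

section Alpha2
variable {R : Type u} [CommRing R]

lemma alpha2_one : alpha2 (1 : R) = ⊤ := by
  ext p; simp [alpha2]

lemma alpha2_zero : alpha2 (0 : R) = ⊥ := by
  ext p; simp [alpha2]

lemma alpha2_mul (a b : R) : alpha2 (a * b) = alpha2 a ⊓ alpha2 b := by
  ext p
  change a * b ∉ p.asIdeal ↔ a ∉ p.asIdeal ∧ b ∉ p.asIdeal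
  rw [p.2.mul_mem_iff_mem_or_mem, not_or]

lemma alpha2_add_le (a b : R) : alpha2 (a + b) ≤ alpha2 a ⊔ alpha2 b := by
  intro p hp
  change a ∉ p.asIdeal ∨ b ∉ p.asIdeal
  by_contra! hc
  exact hp (p.asIdeal.add_mem hc.1 hc.2)

lemma alpha1_map_alpha2 {A B : CommRingCat.{u}} (φ : A ⟶ B) (a : A) :
    (alpha1.map φ).hom (alpha2 a) = alpha2 (φ.hom a) := rfl

end Alpha2

section Loc
variable {R : Type u} [CommRing R]

/-- The map of localizations given by an inclusion of multiplicative systems. -/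
noncomputable def locMap {M N : Submonoid R} (h : M ≤ N) : Localization M →+* Localization N :=
  IsLocalization.lift (M := M) (g := algebraMap R (Localization N))
    fun y => IsLocalization.map_units _ (⟨y.1, h y.2⟩ : N)

lemma locMap_algebraMap {M N : Submonoid R} (h : M ≤ N) (a : R) :
    locMap h (algebraMap R _ a) = algebraMap R _ a :=
  IsLocalization.lift_eq _ _

lemma locMap_self {M : Submonoid R} (h : M ≤ M) : locMap h = RingHom.id _ :=
  IsLocalization.ringHom_ext M <| RingHom.ext fun a => locMap_algebraMap h a

lemma locMap_comp {M N P : Submonoid R} (h : M ≤ N) (h' : N ≤ P) :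
    (locMap h').comp (locMap h) = locMap (h.trans h') :=
  IsLocalization.ringHom_ext M <| RingHom.ext fun a => by
    simp only [RingHom.comp_apply, locMap_algebraMap]

/-- The map of localizations induced by a ring homomorphism. -/
noncomputable def locMapAlong {S : Type u} [CommRing S] (φ : R →+* S) {M : Submonoid R}
    {N : Submonoid S} (h : M ≤ N.comap φ) : Localization M →+* Localization N :=
  IsLocalization.lift (M := M) (g := (algebraMap S (Localization N)).comp φ)
    fun y => IsLocalization.map_units _ (⟨φ y.1, h y.2⟩ : N)

lemma locMapAlong_algebraMap {S : Type u} [CommRing S] (φ : R →+* S) {M : Submonoid R}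
    {N : Submonoid S} (h : M ≤ N.comap φ) (a : R) :
    locMapAlong φ h (algebraMap R _ a) = algebraMap S _ (φ a) :=
  IsLocalization.lift_eq _ _

end Loc

lemma alpha2_induction {R : Type u} [CommRing R] {P : CompactOpens (PrimeSpectrum R) → Prop}
    (bot : P ⊥) (sup : ∀ a K, P K → P (alpha2 a ⊔ K)) (K : CompactOpens (PrimeSpectrum R)) :
    P K := by
  obtain ⟨s, hs, hK⟩ := (isCompact_open_iff_eq_finite_iUnion_of_isTopologicalBasis
    (fun a : R => (PrimeSpectrum.basicOpen a : Set (PrimeSpectrum R)))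
    PrimeSpectrum.isTopologicalBasis_basic_opens PrimeSpectrum.isCompact_basicOpen K).mp
      ⟨K.isCompact, K.isOpen⟩
  suffices ∀ K' : CompactOpens (PrimeSpectrum R),
      (K' : Set (PrimeSpectrum R)) = ⋃ a ∈ s, (PrimeSpectrum.basicOpen a : Set _) → P K' from
    this K hK
  clear hK K
  induction s, hs using Set.Finite.induction_on with
  | empty =>
    intro K hK
    obtain rfl : K = ⊥ := CompactOpens.ext (by simpa using hK)
    exact bot
  | insert _ hs ih =>
    intro K hK
    rename_i a s _
    rw [Set.biUnion_insert] at hK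
    have hc : IsCompact (⋃ a ∈ s, (PrimeSpectrum.basicOpen a : Set (PrimeSpectrum R))) :=
      hs.isCompact_biUnion fun i _ => PrimeSpectrum.isCompact_basicOpen i
    have ho : IsOpen (⋃ a ∈ s, (PrimeSpectrum.basicOpen a : Set (PrimeSpectrum R))) :=
      isOpen_biUnion fun i _ => (PrimeSpectrum.basicOpen i).isOpen
    obtain rfl : K = alpha2 a ⊔ ⟨⟨_, hc⟩, ho⟩ := CompactOpens.ext hK
    exact sup _ _ (ih _ rfl)

/-! ### The spectrum of a ring as an `𝒜`-scheme -/

section Spec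
variable (R : Type u) [CommRing R]

/-- The underlying space of `Spec^𝒜 R`: the spectrum of the lattice `α₁(R)`. -/
abbrev SpecSpace : Type u := LatSpec (CompactOpens (PrimeSpectrum R))

variable {R}

/-- The multiplicative system of all `a ∈ R` such that `Z ⊆ D(α₂(a))`. -/
def mulSys (Z : CompactOpens (SpecSpace R)) : Submonoid R where
  carrier := {x | Z ≤ LatSpec.basic (alpha2 x)}
  one_mem' := fun p _ => by
    change alpha2 (1 : R) ∉ p.asIdeal
    rw [alpha2_one]
    exact p.top_notMem
  mul_mem' := fun {a b} ha hb p hp => by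
    change alpha2 (a * b) ∉ p.asIdeal
    rw [alpha2_mul]
    exact fun h => (p.mem_or_mem h).elim (ha hp) (hb hp)

lemma mem_mulSys {Z : CompactOpens (SpecSpace R)} {a : R} :
    a ∈ mulSys Z ↔ Z ≤ LatSpec.basic (alpha2 a) := Iff.rfl

lemma mulSys_anti {Z W : CompactOpens (SpecSpace R)} (h : W ≤ Z) : mulSys Z ≤ mulSys W :=
  fun _ ha => mem_mulSys.mpr (h.trans (mem_mulSys.mp ha))

variable (R) in
/-- The presheaf `Z ↦ R_Z`, where `R_Z` is the localization of `R` at `mulSys Z`. -/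
noncomputable def preStr : (CompactOpens (SpecSpace R))ᵒᵖ ⥤ CommRingCat.{u} where
  obj Z := CommRingCat.of (Localization (mulSys Z.unop))
  map {Z W} i := CommRingCat.ofHom
    (locMap (mulSys_anti i.unop.le))
  map_id Z := congrArg CommRingCat.ofHom (locMap_self _)
  map_comp i j := (congrArg CommRingCat.ofHom
    (locMap_comp (mulSys_anti i.unop.le) (mulSys_anti j.unop.le))).symm

/-- The prime ideal of `R` at a point of the spectrum. -/
def pt (x : SpecSpace R) : PrimeSpectrum R where
  asIdeal :=
    { carrier := {a | alpha2 a ∈ x.asIdeal}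
      add_mem' := fun ha hb =>
        x.asIdeal.lower (alpha2_add_le _ _) (Order.Ideal.sup_mem ha hb)
      zero_mem' := by
        change alpha2 (0 : R) ∈ x.asIdeal
        rw [alpha2_zero]; exact x.asIdeal.bot_mem
      smul_mem' := fun c a ha => by
        change alpha2 (c * a) ∈ x.asIdeal
        rw [alpha2_mul]
        exact x.asIdeal.lower inf_le_right ha }
  isPrime :=
    { ne_top' := fun h => x.top_notMem <| by
        rw [← alpha2_one]
        exact (Ideal.eq_top_iff_one _).mp h
      mem_or_mem' := fun {a b} h => x.mem_or_mem <| by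
        rw [← alpha2_mul]; exact h }

lemma mem_pt {x : SpecSpace R} {a : R} : a ∈ (pt x).asIdeal ↔ alpha2 a ∈ x.asIdeal := Iff.rfl

lemma mem_iff_pt_mem {x : SpecSpace R} {K : CompactOpens (PrimeSpectrum R)} :
    K ∉ x.asIdeal ↔ pt x ∈ K := by
  induction K using alpha2_induction with
  | bot => exact ⟨fun h => absurd x.asIdeal.bot_mem h, fun h => absurd h (Set.notMem_empty _)⟩
  | sup a K ih =>
    rw [Order.Ideal.sup_mem_iff, not_and_or, ih]
    exact Iff.rfl

lemma mulSys_le {Z : CompactOpens (SpecSpace R)} {x : SpecSpace R} (hx : x ∈ Z) :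
    mulSys Z ≤ (pt x).asIdeal.primeCompl :=
  fun _ ha h => mem_mulSys.mp ha hx h

variable (R) in
/-- The sheaf of products of local rings (used to construct `β`). -/
noncomputable def god : (CompactOpens (SpecSpace R))ᵒᵖ ⥤ CommRingCat.{u} where
  obj Z := CommRingCat.of (∀ x : Z.unop, Localization.AtPrime (pt x.1).asIdeal)
  map {Z W} i := CommRingCat.ofHom
    { toFun := fun s x => s ⟨x.1, i.unop.le x.2⟩
      map_one' := rfl
      map_mul' := fun _ _ => rfl
      map_zero' := rfl
      map_add' := fun _ _ => rfl }
  map_id Z := rfl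
  map_comp i j := rfl

lemma god_isSheaf : Presheaf.IsSheaf (cptTopology (SpecSpace R)) (god R) := by
  classical
  rw [Presheaf.isSheaf_iff_isSheaf_forget _ _ (forget CommRingCat), isSheaf_iff_isSheaf_of_type]
  intro U S hS fam hfam
  have key : ∀ {V W : CompactOpens (SpecSpace R)} (i : V ⟶ U) (j : W ⟶ U) (hi : S i) (hj : S j)
      (x : SpecSpace R) (hV : x ∈ V) (hW : x ∈ W),
      (fam i hi : (god R).obj (op V)) ⟨x, hV⟩ = (fam j hj : (god R).obj (op W)) ⟨x, hW⟩ := by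
    intro V W i j hi hj x hV hW
    have h := hfam (homOfLE inf_le_left : V ⊓ W ⟶ V) (homOfLE inf_le_right : V ⊓ W ⟶ W) hi hj
      (Subsingleton.elim _ _)
    exact congrFun h (⟨x, hV, hW⟩ : (V ⊓ W : CompactOpens (SpecSpace R)))
  choose V i hi hV using hS
  refine ⟨(fun x : U => (fam (i x.1 x.2) (hi x.1 x.2) : (god R).obj (op (V x.1 x.2)))
    ⟨x.1, hV x.1 x.2⟩ : (god R).obj (op U)), ?_, ?_⟩
  · intro W j hj
    funext x
    exact key _ _ _ _ _ _ _
  · intro t ht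
    funext x
    exact congrFun (ht (i x.1 x.2) (hi x.1 x.2)) ⟨x.1, hV x.1 x.2⟩

variable (R) in
/-- The map from `R_Z` to the product of the local rings at the points of `Z`. -/
noncomputable def preStrToGod : preStr R ⟶ god R where
  app Z := CommRingCat.ofHom (RingHom.pi fun x : Z.unop => locMap (mulSys_le x.2))
  naturality Z W i := by
    ext1
    refine RingHom.ext fun s => funext fun x => ?_
    exact congrArg (· s) (locMap_comp (mulSys_anti i.unop.le) (mulSys_le x.2))

variable (R) in
/-- The structure sheaf of `Spec^𝒜 R`: the sheafification of the presheaf `Z ↦ R_Z`. -/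
noncomputable abbrev str : (CompactOpens (SpecSpace R))ᵒᵖ ⥤ CommRingCat.{u} :=
  sheafify (cptTopology (SpecSpace R)) (preStr R)

variable (R) in
lemma str_isSheaf : Presheaf.IsSheaf (cptTopology (SpecSpace R)) (str R) :=
  ((presheafToSheaf _ _).obj (preStr R)).property

variable (R) in
/-- The map from sections of the structure sheaf to products of local rings. -/
noncomputable def strToGod : str R ⟶ god R :=
  sheafifyLift _ (preStrToGod R) god_isSheaf

/-- The evaluation of a section in the local ring at a point. -/
noncomputable def ev {Z : CompactOpens (SpecSpace R)} (x : SpecSpace R) (hx : x ∈ Z) :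
    (str R).obj (op Z) →+* Localization.AtPrime (pt x).asIdeal :=
  (Pi.evalRingHom (fun x : Z => Localization.AtPrime (pt x.1).asIdeal) ⟨x, hx⟩).comp
    ((strToGod R).app (op Z)).hom

lemma ev_map {Z W : CompactOpens (SpecSpace R)} (i : W ⟶ Z) (x : SpecSpace R) (hx : x ∈ W)
    (s : (str R).obj (op Z)) : ev x hx ((str R).map i.op s) = ev x (i.le hx) s :=
  congrFun (NatTrans.naturality_apply (strToGod R) i.op s) ⟨x, hx⟩

/-- The canonical map `R_Z → 𝒪(Z)`. -/
noncomputable def toStr (Z : CompactOpens (SpecSpace R)) :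
    Localization (mulSys Z) →+* (str R).obj (op Z) :=
  ((toSheafify (cptTopology (SpecSpace R)) (preStr R)).app (op Z)).hom

lemma map_toStr {Z W : CompactOpens (SpecSpace R)} (i : W ⟶ Z) (s : Localization (mulSys Z)) :
    (str R).map i.op (toStr Z s) = toStr W (locMap (mulSys_anti i.le) s) :=
  (NatTrans.naturality_apply (toSheafify (cptTopology (SpecSpace R)) (preStr R)) i.op s).symm

lemma ev_toStr {Z : CompactOpens (SpecSpace R)} (x : SpecSpace R) (hx : x ∈ Z)
    (s : Localization (mulSys Z)) : ev x hx (toStr Z s) = locMap (mulSys_le hx) s := by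
  have h := NatTrans.congr_app (toSheafify_sheafifyLift (cptTopology (SpecSpace R))
    (preStrToGod R) god_isSheaf) (op Z)
  have h' := ConcreteCategory.congr_hom h s
  exact congrFun h' ⟨x, hx⟩

/-- Locally, a section is a fraction. -/
lemma exists_local {Z : CompactOpens (SpecSpace R)} (s : (str R).obj (op Z)) (x : SpecSpace R)
    (hx : x ∈ Z) : ∃ (W : CompactOpens (SpecSpace R)) (i : W ⟶ Z) (a : R) (b : mulSys W),
      x ∈ W ∧ (str R).map i.op s = toStr W (Localization.mk a b) := by
  obtain ⟨W, i, ⟨t, ht⟩, hxW⟩ := Presheaf.imageSieve_mem (cptTopology (SpecSpace R))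
    (toSheafify (cptTopology (SpecSpace R)) (preStr R)) s x hx
  obtain ⟨⟨a, b⟩, rfl⟩ := Localization.mkHom_surjective (S := mulSys W) t
  exact ⟨W, i, a, b, hxW, ht.symm⟩

end Spec

lemma exists_compactOpens_of_local {X : Type u} [TopologicalSpace X] [QuasiSeparatedSpace X]
    (Z : CompactOpens X) (T : Set X) (hT : T ⊆ Z)
    (h : ∀ x ∈ Z, ∃ W W' : CompactOpens X, x ∈ W ∧ (W : Set X) ∩ T = W') :
    IsCompact T ∧ IsOpen T := by
  choose W W' hW hW' using h
  obtain ⟨t, ht⟩ := Z.isCompact.elim_finite_subcover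
    (fun x : Z => (W x.1 x.2 : Set X)) (fun x => (W x.1 x.2).isOpen)
    (fun x hx => Set.mem_iUnion.mpr ⟨⟨x, hx⟩, hW x hx⟩)
  have hT' : T = ⋃ x ∈ t, (W' x.1 x.2 : Set X) := by
    apply Set.Subset.antisymm
    · intro y hy
      obtain ⟨x, hx, hyx⟩ := Set.mem_iUnion₂.mp (ht (hT hy))
      refine Set.mem_iUnion₂.mpr ⟨x, hx, ?_⟩
      rw [← hW' x.1 x.2]
      exact ⟨hyx, hy⟩
    · refine Set.iUnion₂_subset fun x _ => ?_
      rw [← hW' x.1 x.2]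
      exact Set.inter_subset_right
  rw [hT']
  exact ⟨t.isCompact_biUnion fun x _ => (W' x.1 x.2).isCompact,
    isOpen_biUnion fun x _ => (W' x.1 x.2).isOpen⟩

section Spec
variable {R : Type u} [CommRing R]

/-- The prime ideal of `𝒪(Z)` of all sections which are not invertible in the local ring at `x`. -/
noncomputable def secPt {Z : CompactOpens (SpecSpace R)} (x : SpecSpace R) (hx : x ∈ Z) :
    PrimeSpectrum ((str R).obj (op Z)) :=
  PrimeSpectrum.comap (ev x hx) (IsLocalRing.closedPoint _)

lemma secPt_mem_alpha2 {Z : CompactOpens (SpecSpace R)} {x : SpecSpace R} {hx : x ∈ Z}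
    {s : (str R).obj (op Z)} : secPt x hx ∈ alpha2 s ↔ IsUnit (ev x hx s) :=
  IsLocalRing.notMem_maximalIdeal

lemma isUnit_locMap_mk {Z : CompactOpens (SpecSpace R)} {x : SpecSpace R} (hx : x ∈ Z)
    (a : R) (b : mulSys Z) :
    IsUnit (locMap (mulSys_le hx) (Localization.mk a b)) ↔ x ∈ LatSpec.basic (alpha2 a) := by
  have hb : IsUnit (locMap (mulSys_le hx) (algebraMap R _ (b : R))) :=
    (IsLocalization.map_units (Localization (mulSys Z)) b).map (locMap (mulSys_le hx))
  have h : locMap (mulSys_le hx) (Localization.mk a b) *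
      locMap (mulSys_le hx) (algebraMap R _ (b : R)) = algebraMap R _ a := by
    rw [← map_mul, Localization.mk_eq_mk', IsLocalization.mk'_spec, locMap_algebraMap]
  have h' : IsUnit (locMap (mulSys_le hx) (Localization.mk a b)) ↔
      IsUnit (algebraMap R (Localization.AtPrime (pt x).asIdeal) a) := by
    rw [← h, IsUnit.mul_iff]
    exact ⟨fun h => ⟨h, hb⟩, fun h => h.1⟩
  rw [h', IsLocalization.AtPrime.isUnit_to_map_iff _ (pt x).asIdeal]
  exact Iff.rfl

lemma specBeta_aux (Z : CompactOpens (SpecSpace R))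
    (K : CompactOpens (PrimeSpectrum ((str R).obj (op Z)))) :
    IsCompact {x | ∃ hx : x ∈ Z, secPt x hx ∈ K} ∧ IsOpen {x | ∃ hx : x ∈ Z, secPt x hx ∈ K} := by
  induction K using alpha2_induction with
  | bot =>
    have h : {x | ∃ hx : x ∈ Z, secPt x hx ∈ (⊥ : CompactOpens _)} = ∅ :=
      Set.eq_empty_of_forall_notMem fun x ⟨_, h⟩ => h
    rw [h]
    exact ⟨isCompact_empty, isOpen_empty⟩
  | sup s K ih =>
    have h : {x | ∃ hx : x ∈ Z, secPt x hx ∈ alpha2 s ⊔ K} =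
        {x | ∃ hx : x ∈ Z, secPt x hx ∈ alpha2 s} ∪ {x | ∃ hx : x ∈ Z, secPt x hx ∈ K} :=
      Set.ext fun x =>
        ⟨fun ⟨hx, h⟩ => h.elim (fun h => Or.inl ⟨hx, h⟩) (fun h => Or.inr ⟨hx, h⟩),
          fun h => h.elim (fun ⟨hx, h⟩ => ⟨hx, Or.inl h⟩) (fun ⟨hx, h⟩ => ⟨hx, Or.inr h⟩)⟩
    have h1 : IsCompact {x | ∃ hx : x ∈ Z, secPt x hx ∈ alpha2 s} ∧
        IsOpen {x | ∃ hx : x ∈ Z, secPt x hx ∈ alpha2 s} := by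
      refine exists_compactOpens_of_local Z _ (fun x hx => hx.1) fun x hx => ?_
      obtain ⟨W, i, a, b, hxW, hs⟩ := exists_local s x hx
      refine ⟨W, W ⊓ LatSpec.basic (alpha2 a), hxW, ?_⟩
      have key : ∀ y (hy : y ∈ W), secPt y (i.le hy) ∈ alpha2 s ↔
          y ∈ LatSpec.basic (alpha2 a) := fun y hy => by
        rw [secPt_mem_alpha2, ← ev_map i y hy s, hs, ev_toStr y hy]
        exact isUnit_locMap_mk hy a b
      ext y
      exact ⟨fun ⟨hy, _, h⟩ => ⟨hy, (key y hy).mp h⟩,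
        fun ⟨hy, h⟩ => ⟨hy, i.le hy, (key y hy).mpr h⟩⟩
    rw [h]
    exact ⟨h1.1.union ih.1, h1.2.union ih.2⟩

/-- The component of `β` at `Z`. It sends `α₂(s)`, for a section `s`, to the set of all points
of `Z` at which `s` is invertible. -/
noncomputable def specBetaFun (Z : CompactOpens (SpecSpace R)) :
    BoundedLatticeHom (CompactOpens (PrimeSpectrum ((str R).obj (op Z)))) (Set.Iic Z) where
  toFun K := ⟨⟨⟨{x | ∃ hx : x ∈ Z, secPt x hx ∈ K}, (specBeta_aux Z K).1⟩, (specBeta_aux Z K).2⟩,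
    Set.mem_Iic.mpr fun _ hx => hx.1⟩
  map_sup' K K' := by
    refine Subtype.ext (CompactOpens.ext (Set.ext fun x => ?_))
    exact ⟨fun ⟨hx, h⟩ => h.elim (fun h => Or.inl ⟨hx, h⟩) (fun h => Or.inr ⟨hx, h⟩),
      fun h => h.elim (fun ⟨hx, h⟩ => ⟨hx, Or.inl h⟩) (fun ⟨hx, h⟩ => ⟨hx, Or.inr h⟩)⟩
  map_inf' K K' := by
    refine Subtype.ext (CompactOpens.ext (Set.ext fun x => ?_))
    exact ⟨fun ⟨hx, h⟩ => ⟨⟨hx, h.1⟩, ⟨hx, h.2⟩⟩, fun ⟨⟨hx, h⟩, ⟨_, h'⟩⟩ => ⟨hx, h, h'⟩⟩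
  map_top' := by
    refine Subtype.ext (CompactOpens.ext (Set.ext fun x => ?_))
    exact ⟨fun ⟨hx, _⟩ => hx, fun hx => ⟨hx, trivial⟩⟩
  map_bot' := by
    refine Subtype.ext (CompactOpens.ext (Set.ext fun x => ?_))
    exact ⟨fun ⟨_, h⟩ => h, fun h => h.elim⟩

lemma mem_specBetaFun {Z : CompactOpens (SpecSpace R)}
    {K : CompactOpens (PrimeSpectrum ((str R).obj (op Z)))} {x : SpecSpace R} :
    x ∈ (specBetaFun Z K).1 ↔ ∃ hx : x ∈ Z, secPt x hx ∈ K := Iff.rfl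

lemma comap_secPt {Z W : CompactOpens (SpecSpace R)} (i : W ⟶ Z) (x : SpecSpace R) (hx : x ∈ W) :
    PrimeSpectrum.comap ((str R).map i.op).hom (secPt x hx) = secPt x (i.le hx) := by
  apply PrimeSpectrum.ext
  ext s
  exact iff_of_eq (congrArg (· ∈ IsLocalRing.maximalIdeal _) (ev_map i x hx s))

variable (R) in
/-- The morphism `β` of `Spec^𝒜 R`. By `specBeta_spec` it sends the image of `K ∈ α₁(R)` in
`α₁(𝒪(Z))` to the open set `D(K) ∩ Z`, for each `Z`; as sections of the structure sheaf are locally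
fractions, this property determines it. -/
noncomputable def specBeta : str R ⋙ alpha1 ⟶ tau (SpecSpace R) where
  app Z := BddDistLat.ofHom (specBetaFun Z.unop)
  naturality Z W i := by
    refine BddDistLat.ext fun (K : CompactOpens (PrimeSpectrum ((str R).obj Z))) =>
      Subtype.ext (CompactOpens.ext (Set.ext fun x => ?_))
    constructor
    · rintro ⟨hx, h⟩
      have h' : PrimeSpectrum.comap ((str R).map i).hom (secPt x hx) ∈ K := h
      exact ⟨⟨i.unop.le hx, (comap_secPt i.unop x hx) ▸ h'⟩, hx⟩
    · rintro ⟨⟨_, h⟩, hx⟩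
      have hK : PrimeSpectrum.comap ((str R).map i).hom (secPt x hx) ∈ K :=
        (comap_secPt i.unop x hx).symm ▸ h
      exact ⟨hx, hK⟩

/-- `β` is the morphism induced by the canonical map `α₁(R) → C(Spec^𝒜 R)_cpt`, `K ↦ D(K)`. -/
lemma specBeta_spec (Z : CompactOpens (SpecSpace R)) (K : CompactOpens (PrimeSpectrum R)) :
    (specBetaFun Z (pre ⟨PrimeSpectrum.comap ((toStr Z).comp (algebraMap R _)),
      isSpectralMap_comap _⟩ K)).1 = LatSpec.basic K ⊓ Z := by
  refine CompactOpens.ext (Set.ext fun x => ?_)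
  have key : ∀ hx : x ∈ Z, PrimeSpectrum.comap ((toStr Z).comp (algebraMap R _)) (secPt x hx) =
      pt x := by
    intro hx
    apply PrimeSpectrum.ext
    ext a
    change ev x hx (toStr Z (algebraMap R _ a)) ∈ IsLocalRing.maximalIdeal _ ↔ _
    rw [ev_toStr, locMap_algebraMap]
    exact IsLocalization.AtPrime.to_map_mem_maximal_iff _ (pt x).asIdeal a
  constructor
  · rintro ⟨hx, h⟩
    have h' : PrimeSpectrum.comap ((toStr Z).comp (algebraMap R _)) (secPt x hx) ∈ K := h
    exact ⟨mem_iff_pt_mem.mpr (key hx ▸ h'), hx⟩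
  · rintro ⟨h, hx⟩
    have h' : PrimeSpectrum.comap ((toStr Z).comp (algebraMap R _)) (secPt x hx) ∈ K :=
      (key hx).symm ▸ mem_iff_pt_mem.mp h
    exact ⟨hx, h'⟩

lemma isUnit_map_of_le {Z W : CompactOpens (SpecSpace R)} (i : W ⟶ Z) (s : (str R).obj (op Z))
    (h : W ≤ (specBetaFun Z (alpha2 s)).1) : IsUnit ((str R).map i.op s) := by
  refine isUnit_of_local (str_isSheaf R) fun x hx => ?_
  obtain ⟨V, j, a, b, hxV, hs⟩ := exists_local ((str R).map i.op s) x hx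
  refine ⟨V, j, hxV, ?_⟩
  rw [hs]
  have ha : a ∈ mulSys V := by
    refine mem_mulSys.mpr fun y hy => ?_
    obtain ⟨hy', hu⟩ := h (j.le hy)
    rw [secPt_mem_alpha2, ← ev_map i y (j.le hy) s, ← ev_map j y hy, hs, ev_toStr y hy] at hu
    exact (isUnit_locMap_mk hy a b).mp hu
  have hu : IsUnit (Localization.mk a b : Localization (mulSys V)) := by
    rw [Localization.mk_eq_mk', IsLocalization.mk'_eq_mul_mk'_one]
    refine (IsLocalization.map_units _ (⟨a, ha⟩ : mulSys V)).mul ?_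
    refine IsUnit.of_mul_eq_one (algebraMap R _ (b : R)) ?_
    rw [IsLocalization.mk'_spec, map_one]
  exact hu.map (toStr V)

variable (R) in
/-- The `𝒜`-scheme `Spec^𝒜 R`. -/
noncomputable def specObj : AScheme.{u} where
  carrier := SpecSpace R
  presheaf := str R
  isSheaf := str_isSheaf R
  β := specBeta R
  reflects Z W h a ha := by
    have hu := isUnit_map_of_le (homOfLE h) a ha
    refine ⟨IsLocalization.Away.lift (S := Localization.Away a) a
      (g := ((str R).map (homOfLE h).op).hom) hu, ?_⟩
    exact IsLocalization.Away.lift_comp a hu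

section Map
variable {A B : Type u} [CommRing A] [CommRing B] (φ : B →+* A)

/-- The map of underlying spaces induced by a homomorphism of rings `φ : B → A`. -/
def specBase : SpectralMap (SpecSpace A) (SpecSpace B) :=
  LatSpec.comap (alpha1.map (CommRingCat.ofHom φ)).hom

lemma pt_specBase (x : SpecSpace A) :
    (pt (specBase φ x)).asIdeal = (pt x).asIdeal.comap φ := rfl

lemma mulSys_le_comap (Z : CompactOpens (SpecSpace B)) :
    mulSys Z ≤ (mulSys (pre (specBase φ) Z)).comap φ :=
  fun _ ha x hx => ha hx

/-- The homomorphisms `B_Z → A_{f⁻¹(Z)}` of localizations induced by `φ`. -/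
noncomputable def preStrMap : preStr B ⟶ (preFunctor (specBase φ)).op ⋙ preStr A where
  app Z := CommRingCat.ofHom (locMapAlong φ (mulSys_le_comap φ Z.unop))
  naturality Z W i := by
    ext1
    refine IsLocalization.ringHom_ext (S := Localization (mulSys Z.unop)) (mulSys Z.unop)
      (RingHom.ext fun a => ?_)
    exact ((congrArg (locMapAlong φ (mulSys_le_comap φ W.unop))
      (locMap_algebraMap (mulSys_anti i.unop.le) a)).trans (locMapAlong_algebraMap φ _ a)).trans
      ((congrArg (locMap (mulSys_anti (OrderHomClass.mono (pre (specBase φ)) i.unop.le)))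
        (locMapAlong_algebraMap φ (mulSys_le_comap φ Z.unop) a)).trans
          (locMap_algebraMap _ _)).symm

/-- The morphism of structure sheaves induced by `φ`. -/
noncomputable def strMap : str B ⟶ (preFunctor (specBase φ)).op ⋙ str A :=
  sheafifyLift _ (preStrMap φ ≫ Functor.whiskerLeft _ (toSheafify _ (preStr A)))
    (isSheaf_pushforward _ (str_isSheaf A))

lemma strMap_toStr (Z : CompactOpens (SpecSpace B)) (s : Localization (mulSys Z)) :
    (strMap φ).app (op Z) (toStr Z s) = toStr _ (locMapAlong φ (mulSys_le_comap φ Z) s) := by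
  have h := NatTrans.congr_app (toSheafify_sheafifyLift (cptTopology (SpecSpace B))
    (preStrMap φ ≫ Functor.whiskerLeft _ (toSheafify _ (preStr A)))
    (isSheaf_pushforward (specBase φ) (str_isSheaf A))) (op Z)
  exact ConcreteCategory.congr_hom h s

lemma ev_strMap {Z : CompactOpens (SpecSpace B)} (x : SpecSpace A) (hx : specBase φ x ∈ Z)
    (s : (str B).obj (op Z)) :
    ev (Z := pre (specBase φ) Z) x hx ((strMap φ).app (op Z) s) =
      Localization.localRingHom _ _ φ (pt_specBase φ x) (ev (specBase φ x) hx s) := by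
  obtain ⟨W, i, a, b, hxW, hs⟩ := exists_local s (specBase φ x) hx
  have h1 : ev (Z := pre (specBase φ) Z) x hx ((strMap φ).app (op Z) s) =
      ev (Z := pre (specBase φ) W) x hxW ((strMap φ).app (op W) ((str B).map i.op s)) := by
    have h := ev_map (Z := pre (specBase φ) Z) (W := pre (specBase φ) W)
      ((preFunctor (specBase φ)).map i) x hxW ((strMap φ).app (op Z) s)
    refine h.symm.trans (congrArg (ev (Z := pre (specBase φ) W) x hxW) ?_)
    exact (NatTrans.naturality_apply (strMap φ) i.op s).symm
  have h2 : (locMap (mulSys_le (Z := pre (specBase φ) W) (x := x) hxW)).comp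
      (locMapAlong φ (mulSys_le_comap φ W)) =
      (Localization.localRingHom _ _ φ (pt_specBase φ x)).comp (locMap (mulSys_le hxW)) := by
    refine IsLocalization.ringHom_ext (mulSys W) (RingHom.ext fun c => ?_)
    simp only [RingHom.comp_apply, locMapAlong_algebraMap, locMap_algebraMap]
    exact (Localization.localRingHom_to_map _ _ φ (pt_specBase φ x) c).symm
  rw [h1, ← ev_map i (specBase φ x) hxW s, hs, strMap_toStr, ev_toStr (specBase φ x) hxW]
  exact (ev_toStr (Z := pre (specBase φ) W) x hxW _).trans (RingHom.congr_fun h2 _)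

/-- The morphism of `𝒜`-schemes induced by `φ`. -/
noncomputable def specMap : specObj A ⟶ specObj B :=
  AScheme.Hom.mk (X := specObj A) (Y := specObj B) (specBase φ) (strMap φ) <| by
    apply NatTrans.ext
    funext Z
    refine BddDistLat.ext fun (K : CompactOpens (PrimeSpectrum ((str B).obj Z))) =>
      Subtype.ext (CompactOpens.ext (Set.ext fun (x : SpecSpace A) => ?_))
    have key : ∀ hx : specBase φ x ∈ Z.unop,
        PrimeSpectrum.comap ((strMap φ).app Z).hom (secPt (Z := pre (specBase φ) Z.unop) x hx) =
          secPt (specBase φ x) hx := by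
      intro hx
      apply PrimeSpectrum.ext
      ext s
      change ev (Z := pre (specBase φ) Z.unop) x hx ((strMap φ).app Z s) ∈
        IsLocalRing.maximalIdeal _ ↔ ev (specBase φ x) hx s ∈ IsLocalRing.maximalIdeal _
      rw [IsLocalRing.mem_maximalIdeal, IsLocalRing.mem_maximalIdeal, mem_nonunits_iff,
        mem_nonunits_iff, not_iff_not]
      have h := ev_strMap φ x hx s
      have h' := isUnit_map_iff (Localization.localRingHom _ _ φ (pt_specBase φ x))
        (ev (specBase φ x) hx s)
      exact (iff_of_eq (congrArg IsUnit h)).trans h'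
    constructor
    · rintro ⟨hx, h⟩
      have h' : PrimeSpectrum.comap ((strMap φ).app Z).hom
          (secPt (Z := pre (specBase φ) Z.unop) x hx) ∈ K := h
      exact ⟨hx, key hx ▸ h'⟩
    · rintro ⟨hx, h⟩
      have h' : PrimeSpectrum.comap ((strMap φ).app Z).hom
          (secPt (Z := pre (specBase φ) Z.unop) x hx) ∈ K := (key hx).symm ▸ h
      exact ⟨hx, h'⟩

end Map

lemma hom_specObj_ext {X : AScheme.{u}} {f g : X ⟶ specObj R} (hb : f.base = g.base)
    (hc : ∀ (Z : CompactOpens (SpecSpace R)) (a : R) (h : pre f.base Z ≤ pre g.base Z),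
      f.c.app (op Z) (toStr Z (algebraMap R _ a)) =
        X.presheaf.map (homOfLE h).op (g.c.app (op Z) (toStr Z (algebraMap R _ a)))) : f = g := by
  obtain ⟨b, c, hf⟩ := f
  obtain ⟨b', c', hg⟩ := g
  obtain rfl : b = b' := hb
  have : c = c' := by
    refine sheafify_hom_ext (cptTopology (SpecSpace R)) c c' (isSheaf_pushforward b X.isSheaf) ?_
    apply NatTrans.ext
    funext Z
    apply CommRingCat.hom_ext
    refine IsLocalization.ringHom_ext (S := Localization (mulSys Z.unop)) (mulSys Z.unop)
      (RingHom.ext fun a => ?_)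
    exact (hc Z.unop a le_rfl).trans
      (ConcreteCategory.congr_hom (X.presheaf.map_id _) (c'.app Z (toStr Z.unop (algebraMap R _ a))))
  subst this
  rfl

/-- The spectrum functor `Spec^𝒜` from the opposite category of commutative rings to `𝒜`-schemes. -/
noncomputable def SpecA : CommRingCat.{u}ᵒᵖ ⥤ AScheme.{u} where
  obj R := specObj R.unop
  map φ := specMap φ.unop.hom
  map_id R := by
    refine hom_specObj_ext rfl fun Z a h => ?_
    refine (strMap_toStr _ Z _).trans ?_
    rw [locMapAlong_algebraMap]
    refine Eq.trans ?_ (map_toStr (homOfLE h) (algebraMap _ _ a)).symm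
    rw [locMap_algebraMap]
    rfl
  map_comp {R S T} φ ψ := by
    refine hom_specObj_ext rfl fun Z a h => ?_
    refine (strMap_toStr _ Z _).trans ?_
    rw [locMapAlong_algebraMap]
    have h1 := (strMap_toStr ψ.unop.hom Z (algebraMap _ _ a)).trans
      (congrArg (toStr _) (locMapAlong_algebraMap ψ.unop.hom _ a))
    have h2 := (strMap_toStr φ.unop.hom (pre (specBase ψ.unop.hom) Z)
      (algebraMap _ _ (ψ.unop.hom a))).trans
      (congrArg (toStr _) (locMapAlong_algebraMap φ.unop.hom _ _))
    have h3 := (congrArg ((strMap φ.unop.hom).app (op (pre (specBase ψ.unop.hom) Z))) h1).trans h2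
    let Z1 := pre (specBase (φ ≫ ψ).unop.hom) Z
    let Z2 := pre (specBase φ.unop.hom) (pre (specBase ψ.unop.hom) Z)
    have h' : Z1 ≤ Z2 := h
    exact ((congrArg ((str R.unop).map (homOfLE h').op) h3).trans
      ((map_toStr (homOfLE h') (algebraMap R.unop (Localization (mulSys Z2)) _)).trans
        (congrArg (toStr Z1) (locMap_algebraMap (mulSys_anti h') _)))).symm

end Spec

/-! ### Quasi-compact quasi-separated schemes -/

/-- A quasi-compact and quasi-separated scheme. -/
structure QSch where
  toScheme : AlgebraicGeometry.Scheme.{u}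
  [compactSpace : CompactSpace toScheme]
  [quasiSeparatedSpace : QuasiSeparatedSpace toScheme]

namespace QSch
attribute [instance] compactSpace quasiSeparatedSpace

/-- Morphisms are the quasi-compact morphisms of schemes. -/
instance : Category QSch.{u} where
  Hom X Y := {f : X.toScheme ⟶ Y.toScheme // AlgebraicGeometry.QuasiCompact f}
  id X := ⟨𝟙 _, inferInstance⟩
  comp f g := ⟨f.1 ≫ g.1, haveI := f.2; haveI := g.2; inferInstance⟩
end QSch

/-- The usual functor `Spec`, with values in quasi-compact quasi-separated schemes. -/
noncomputable def SpecQ : CommRingCat.{u}ᵒᵖ ⥤ QSch.{u} where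
  obj R := { toScheme := AlgebraicGeometry.Spec R.unop }
  map φ := ⟨AlgebraicGeometry.Spec.map φ.unop, inferInstance⟩
  map_id R := Subtype.ext (AlgebraicGeometry.Spec.map_id _)
  map_comp φ ψ := Subtype.ext (AlgebraicGeometry.Spec.map_comp _ _)
end ASch

/-!
The functor `I` keeps the underlying space of a quasi-compact quasi-separated scheme `X`, which is
spectral, and restricts the structure sheaf to the quasi-compact open sets (`ofScheme`). For such an
open set `Z`, the map `β` sends `D(s)` to the open set of all points of `Z` at which the section `s`
is invertible; this open set is quasi-compact because `Z` is.

Fully faithfulness. The quasi-compact open sets are a basis, so a morphism of sheaves on them extends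
uniquely to all open sets (`homSheaf`). What has to be seen is that the condition on `β` in the
definition of a morphism of `𝒜`-schemes is the condition that the homomorphisms of stalks are local.
As `α₁(R)` is generated as a lattice by the elements `D(a)` (`boundedLatticeHom_ext`), the condition
on `β` says that the inverse image of the open set where `s` is invertible is the open set where the
pullback of `s` is invertible. This holds for morphisms of schemes (`ofSchemeMap`), and conversely it
implies that a germ is invertible if its image is (`homScheme`).

Affine schemes. A prime ideal of the lattice `α₁(R)` is the set of all quasi-compact open sets which
do not contain a given point of `Spec R`, so the two spectra have the same points and the same
topology (`toSpecSpace`, `pt`). The maps from the localizations `R_Z` to the sections of the usual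
structure sheaf over `Z` are locally injective and locally surjective, since the sets `D(a)` form a
basis and the sections over `D(a)` are the localization of `R` at `a`. So they induce an isomorphism
from the sheafification (`isIso_strToSpec`). The resulting morphism `specComparison` is therefore an
isomorphism of `𝒜`-schemes, and its naturality has to be checked only on elements of the ring.
-/

namespace ASch
open AlgebraicGeometry

/-! ### Sheaves on the quasi-compact open sets -/

section Sheaf
variable (X : Type u) [TopologicalSpace X]

/-- The inclusion of the poset of quasi-compact open sets into the poset of open sets. -/
def toOpensFunctor : CompactOpens X ⥤ Opens X where
  obj U := U.toOpens
  map i := homOfLE i.le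

instance : (toOpensFunctor X).Full where
  map_surjective i := ⟨homOfLE (fun _ hx => i.le hx), Subsingleton.elim _ _⟩

variable {X} in
/-- The quasi-compact open sets form a basis. -/
lemma exists_compactOpens_mem [PrespectralSpace X] {U : Opens X} {x : X} (hx : x ∈ U) :
    ∃ V : CompactOpens X, x ∈ V ∧ V.toOpens ≤ U := by
  obtain ⟨V, ⟨hV, hV'⟩, hxV, hVU⟩ :=
    (PrespectralSpace.isTopologicalBasis (X := X)).exists_subset_of_mem_open hx U.isOpen
  exact ⟨⟨⟨V, hV'⟩, hV⟩, hxV, hVU⟩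

instance isCoverDense_toOpensFunctor [PrespectralSpace X] :
    (toOpensFunctor X).IsCoverDense (Opens.grothendieckTopology X) where
  is_cover U x hx := by
    obtain ⟨V, hxV, hVU⟩ := exists_compactOpens_mem hx
    exact ⟨V.toOpens, homOfLE hVU, ⟨⟨V, 𝟙 _, homOfLE hVU, Subsingleton.elim _ _⟩⟩, hxV⟩

instance isContinuous_toOpensFunctor [QuasiSeparatedSpace X] :
    (toOpensFunctor X).IsContinuous (cptTopology X) (Opens.grothendieckTopology X) := by
  refine Functor.isContinuous_of_coverPreserving ⟨?_⟩ ⟨?_⟩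
  · intro F U T s hs V₁ V₂ W f₁ f₂ g₁ g₂ h₁ h₂ _
    have h := hs (homOfLE inf_le_left : V₁ ⊓ V₂ ⟶ V₁) (homOfLE inf_le_right : V₁ ⊓ V₂ ⟶ V₂)
      h₁ h₂ (Subsingleton.elim _ _)
    have i : W ⟶ (toOpensFunctor X).obj (V₁ ⊓ V₂) := homOfLE (le_inf f₁.le f₂.le)
    have h' := congrArg (F.obj.map i.op) h
    simp only [Functor.comp_map, ← Functor.map_comp_apply] at h'
    exact h'
  · intro U S hS x hx
    obtain ⟨V, g, hg, hV⟩ := hS x hx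
    exact ⟨_, (toOpensFunctor X).map g, Sieve.image_mem_functorPushforward _ _ hg, hV⟩

end Sheaf

/-- Homomorphisms out of `α₁(R)` are determined by their values at the elements `D(a)`. -/
lemma boundedLatticeHom_ext {R L : Type u} [CommRing R] [Lattice L] [BoundedOrder L]
    {f g : BoundedLatticeHom (CompactOpens (PrimeSpectrum R)) L}
    (h : ∀ a : R, f (alpha2 a) = g (alpha2 a)) : f = g := by
  refine DFunLike.ext _ _ fun K => ?_
  induction K using alpha2_induction with
  | bot => rw [map_bot, map_bot]
  | sup a K ih => rw [map_sup, map_sup, h, ih]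

/-! ### The `𝒜`-scheme of a quasi-compact quasi-separated scheme -/

section OfScheme

lemma isUnit_res {X : Scheme.{u}} {U V : X.Opens} (i : V ⟶ U) (s : Γ(X, U))
    (h : V ≤ X.basicOpen s) : IsUnit (X.presheaf.map i.op s) := by
  have hu := (X.toRingedSpace.isUnit_res_basicOpen s).map (X.presheaf.map (homOfLE h).op).hom
  have hi : i = homOfLE h ≫ homOfLE (X.basicOpen_le s) := Subsingleton.elim _ _
  rw [hi, op_comp, X.presheaf.map_comp]
  exact hu

instance spectralSpace_scheme (X : Scheme.{u}) [CompactSpace X] [QuasiSeparatedSpace X] :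
    SpectralSpace X where

variable {X : Scheme.{u}} {Z W : CompactOpens X}

/-- The prime ideal of `𝒪(Z)` of all sections which are not invertible in the local ring at `x`. -/
noncomputable def schemePt (x : X) (hx : x ∈ Z) : PrimeSpectrum Γ(X, Z.toOpens) :=
  PrimeSpectrum.comap (X.presheaf.germ Z.toOpens x hx).hom (IsLocalRing.closedPoint _)

lemma schemePt_mem_alpha2 {x : X} {hx : x ∈ Z} {s : Γ(X, Z.toOpens)} :
    schemePt x hx ∈ alpha2 s ↔ x ∈ X.basicOpen s :=
  IsLocalRing.notMem_maximalIdeal.trans (X.mem_basicOpen s x hx).symm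

lemma comap_schemePt (i : W ⟶ Z) (x : X) (hx : x ∈ W) :
    PrimeSpectrum.comap (X.presheaf.map ((toOpensFunctor X).map i).op).hom (schemePt x hx) =
      schemePt x (i.le hx) := by
  apply PrimeSpectrum.ext
  ext s
  exact iff_of_eq (congrArg (· ∈ IsLocalRing.maximalIdeal _)
    (X.presheaf.germ_res_apply ((toOpensFunctor X).map i) x hx s))

lemma schemeBeta_aux (Z : CompactOpens X) (K : CompactOpens (PrimeSpectrum Γ(X, Z.toOpens))) :
    IsCompact {x | ∃ hx : x ∈ Z, schemePt x hx ∈ K} ∧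
      IsOpen {x | ∃ hx : x ∈ Z, schemePt x hx ∈ K} := by
  induction K using alpha2_induction with
  | bot =>
    have h : {x | ∃ hx : x ∈ Z, schemePt x hx ∈ (⊥ : CompactOpens _)} = ∅ :=
      Set.eq_empty_of_forall_notMem fun x ⟨_, h⟩ => h
    rw [h]
    exact ⟨isCompact_empty, isOpen_empty⟩
  | sup s K ih =>
    have h : {x | ∃ hx : x ∈ Z, schemePt x hx ∈ alpha2 s ⊔ K} =
        (X.basicOpen s : Set X) ∪ {x | ∃ hx : x ∈ Z, schemePt x hx ∈ K} :=
      Set.ext fun x =>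
        ⟨fun ⟨hx, h⟩ => h.elim (fun h => Or.inl (schemePt_mem_alpha2.mp h))
            (fun h => Or.inr ⟨hx, h⟩),
          fun h => h.elim (fun h => ⟨X.basicOpen_le s h, Or.inl (schemePt_mem_alpha2.mpr h)⟩)
            (fun ⟨hx, h⟩ => ⟨hx, Or.inr h⟩)⟩
    rw [h]
    exact ⟨(isCompact_basicOpen X Z.isCompact s).union ih.1, (X.basicOpen s).isOpen.union ih.2⟩

/-- The restriction of the structure sheaf of a scheme to the quasi-compact open sets. -/
noncomputable abbrev cptPresheaf (X : Scheme.{u}) : (CompactOpens X)ᵒᵖ ⥤ CommRingCat.{u} :=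
  (toOpensFunctor X).op ⋙ X.presheaf

lemma cptPresheaf_isSheaf (X : Scheme.{u}) [QuasiSeparatedSpace X] :
    Presheaf.IsSheaf (cptTopology X) (cptPresheaf X) :=
  Functor.op_comp_isSheaf_of_isSheaf (toOpensFunctor X) (cptTopology X)
    (Opens.grothendieckTopology X) X.presheaf X.sheaf.property

variable [QuasiSeparatedSpace X]

/-- The component of `β` at `Z`. It sends `α₂(s)`, for a section `s`, to the open set of all points
of `Z` at which `s` is invertible. -/
noncomputable def schemeBetaFun (Z : CompactOpens X) :
    BoundedLatticeHom (CompactOpens (PrimeSpectrum Γ(X, Z.toOpens))) (Set.Iic Z) where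
  toFun K := ⟨⟨⟨{x | ∃ hx : x ∈ Z, schemePt x hx ∈ K}, (schemeBeta_aux Z K).1⟩,
    (schemeBeta_aux Z K).2⟩, Set.mem_Iic.mpr fun _ hx => hx.1⟩
  map_sup' K K' := by
    refine Subtype.ext (CompactOpens.ext (Set.ext fun x => ?_))
    exact ⟨fun ⟨hx, h⟩ => h.elim (fun h => Or.inl ⟨hx, h⟩) (fun h => Or.inr ⟨hx, h⟩),
      fun h => h.elim (fun ⟨hx, h⟩ => ⟨hx, Or.inl h⟩) (fun ⟨hx, h⟩ => ⟨hx, Or.inr h⟩)⟩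
  map_inf' K K' := by
    refine Subtype.ext (CompactOpens.ext (Set.ext fun x => ?_))
    exact ⟨fun ⟨hx, h⟩ => ⟨⟨hx, h.1⟩, ⟨hx, h.2⟩⟩, fun ⟨⟨hx, h⟩, ⟨_, h'⟩⟩ => ⟨hx, h, h'⟩⟩
  map_top' := by
    refine Subtype.ext (CompactOpens.ext (Set.ext fun x => ?_))
    exact ⟨fun ⟨hx, _⟩ => hx, fun hx => ⟨hx, trivial⟩⟩
  map_bot' := by
    refine Subtype.ext (CompactOpens.ext (Set.ext fun x => ?_))
    exact ⟨fun ⟨_, h⟩ => h, fun h => h.elim⟩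

lemma mem_schemeBetaFun_alpha2 {s : Γ(X, Z.toOpens)} {x : X} :
    x ∈ (schemeBetaFun Z (alpha2 s)).1 ↔ x ∈ X.basicOpen s :=
  ⟨fun ⟨_, h⟩ => schemePt_mem_alpha2.mp h,
    fun h => ⟨X.basicOpen_le s h, schemePt_mem_alpha2.mpr h⟩⟩

variable (X) [CompactSpace X]

/-- The morphism `β` of the `𝒜`-scheme of a scheme. -/
noncomputable def schemeBeta : cptPresheaf X ⋙ alpha1 ⟶ tau X where
  app Z := BddDistLat.ofHom (schemeBetaFun Z.unop)
  naturality Z W i := by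
    refine BddDistLat.ext fun (K : CompactOpens (PrimeSpectrum Γ(X, Z.unop.toOpens))) =>
      Subtype.ext (CompactOpens.ext (Set.ext fun x => ?_))
    constructor
    · rintro ⟨hx, h⟩
      have h' : PrimeSpectrum.comap ((cptPresheaf X).map i).hom (schemePt x hx) ∈ K := h
      exact ⟨⟨i.unop.le hx, (comap_schemePt i.unop x hx) ▸ h'⟩, hx⟩
    · rintro ⟨⟨_, h⟩, hx⟩
      have hK : PrimeSpectrum.comap ((cptPresheaf X).map i).hom (schemePt x hx) ∈ K :=
        (comap_schemePt i.unop x hx).symm ▸ h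
      exact ⟨hx, hK⟩

/-- The `𝒜`-scheme of a quasi-compact quasi-separated scheme. -/
noncomputable def ofScheme : AScheme.{u} where
  carrier := X
  presheaf := cptPresheaf X
  isSheaf := cptPresheaf_isSheaf X
  β := schemeBeta X
  reflects Z W h a ha := by
    have hu : IsUnit ((cptPresheaf X).map (homOfLE h).op a) :=
      isUnit_res ((toOpensFunctor X).map (homOfLE h)) a
        fun x hx => mem_schemeBetaFun_alpha2.mp (ha hx)
    exact ⟨IsLocalization.Away.lift (S := Localization.Away a) a
      (g := ((cptPresheaf X).map (homOfLE h).op).hom) hu, IsLocalization.Away.lift_comp a hu⟩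

end OfScheme

/-! ### Morphisms of `𝒜`-schemes between schemes -/

/-- Morphisms of `𝒜`-schemes agree if they agree on points and on sections. The restriction map in
the second condition makes up for the sections living over open sets which are equal only by the
first condition. -/
lemma AScheme.hom_ext_app {X Y : AScheme.{u}} {f g : X ⟶ Y} (hb : f.base = g.base)
    (hc : ∀ (Z : CompactOpens Y.carrier) (h : pre f.base Z ≤ pre g.base Z),
      f.c.app (op Z) = g.c.app (op Z) ≫ X.presheaf.map (homOfLE h).op) : f = g := by
  obtain ⟨b, c, hf⟩ := f
  obtain ⟨b', c', hg⟩ := g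
  obtain rfl : b = b' := hb
  obtain rfl : c = c' := NatTrans.ext (funext fun Z => (hc Z.unop le_rfl).trans
    ((congrArg (c'.app Z ≫ ·) (X.presheaf.map_id _)).trans (Category.comp_id _)))
  rfl

section HomScheme

variable {X Y : Scheme.{u}} [CompactSpace X] [QuasiSeparatedSpace X] [CompactSpace Y]
  [QuasiSeparatedSpace Y]

/-- The morphism of `𝒜`-schemes given by a quasi-compact morphism of schemes. -/
noncomputable def ofSchemeMap (f : X ⟶ Y) (hf : QuasiCompact f) : ofScheme X ⟶ ofScheme Y :=
  AScheme.Hom.mk (X := ofScheme X) (Y := ofScheme Y) ⟨f, f.isSpectralMap⟩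
    { app := fun V => f.app V.unop.toOpens
      naturality := fun V W i => f.naturality ((toOpensFunctor Y).map i.unop).op } <| by
    apply NatTrans.ext
    funext V
    refine BddDistLat.hom_ext (boundedLatticeHom_ext fun (s : Γ(Y, V.unop.toOpens)) =>
      Subtype.ext (CompactOpens.ext (Set.ext fun (x : X) => ?_)))
    have h := congrArg (x ∈ ·) (f.preimage_basicOpen s)
    exact mem_schemeBetaFun_alpha2.trans ((iff_of_eq h).symm.trans
      (mem_schemeBetaFun_alpha2 (s := s) (x := f x)).symm)

/-- The continuous map underlying a morphism of `𝒜`-schemes between schemes. -/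
noncomputable def homBase (F : ofScheme X ⟶ ofScheme Y) : X.toTopCat ⟶ Y.toTopCat :=
  TopCat.ofHom ⟨F.base, F.base.spectral'.continuous⟩

/-- The morphism of structure sheaves on all open sets which extends the one on quasi-compact open
sets. -/
noncomputable def homSheaf (F : ofScheme X ⟶ ofScheme Y) :
    Y.presheaf ⟶ (TopCat.Presheaf.pushforward _ (homBase F)).obj X.presheaf :=
  Functor.IsCoverDense.restrictHomEquivHom (K := Opens.grothendieckTopology Y)
    (G := toOpensFunctor Y)
    (ℱ' := ⟨(TopCat.Presheaf.pushforward _ (homBase F)).obj X.presheaf,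
      TopCat.Sheaf.pushforward_sheaf_of_sheaf (homBase F) X.sheaf.property⟩) F.c

lemma homSheaf_app (F : ofScheme X ⟶ ofScheme Y) (V : CompactOpens Y) :
    (homSheaf F).app (op V.toOpens) = F.c.app (op V) :=
  NatTrans.congr_app (Functor.IsCoverDense.sheafHom_restrict_eq
    (K := Opens.grothendieckTopology Y) (G := toOpensFunctor Y)
    (ℱ' := ⟨(TopCat.Presheaf.pushforward _ (homBase F)).obj X.presheaf,
      TopCat.Sheaf.pushforward_sheaf_of_sheaf (homBase F) X.sheaf.property⟩) F.c) (op V)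

/-- The compatibility of a morphism of `𝒜`-schemes with `β` means that a section on the target is
invertible at the image of a point as soon as its pullback is invertible at this point. -/
lemma mem_basicOpen_of_hom (F : ofScheme X ⟶ ofScheme Y) {V : CompactOpens Y}
    (s : Γ(Y, V.toOpens)) (x : X)
    (h : x ∈ X.basicOpen (U := (pre F.base V).toOpens) (F.c.app (op V) s)) :
    (F.base x : Y) ∈ Y.basicOpen s := by
  have h1 := congrArg (fun g => g.hom (alpha2 s)) (NatTrans.congr_app F.comm (op V))
  have h2 := congrArg (fun K => x ∈ K.1) h1
  exact mem_schemeBetaFun_alpha2.mp ((iff_of_eq h2).mp (mem_schemeBetaFun_alpha2.mpr h))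

/-- The morphism of schemes given by a morphism of `𝒜`-schemes. -/
noncomputable def homScheme (F : ofScheme X ⟶ ofScheme Y) : X ⟶ Y where
  base := homBase F
  c := homSheaf F
  prop x := by
    refine ⟨fun t ht => ?_⟩
    let f : X.toPresheafedSpace ⟶ Y.toPresheafedSpace := ⟨homBase F, homSheaf F⟩
    obtain ⟨U, hxU, s, rfl⟩ := Y.presheaf.exists_germ_eq t
    obtain ⟨V, hxV, hVU⟩ := exists_compactOpens_mem hxU
    obtain ⟨s', hs⟩ : ∃ s' : Γ(Y, V.toOpens), Y.presheaf.germ V.toOpens (f.base x) hxV s' =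
        Y.presheaf.germ U (f.base x) hxU s :=
      ⟨_, Y.presheaf.germ_res_apply (homOfLE hVU) (f.base x) hxV s⟩
    -- The image of the germ of `s'` is the germ of the pullback, which is therefore invertible at `x`.
    have h1 : f.stalkMap x (Y.presheaf.germ V.toOpens (f.base x) hxV s') =
        X.presheaf.germ (pre F.base V).toOpens x hxV (F.c.app (op V) s') := by
      refine (PresheafedSpace.stalkMap_germ_apply f V.toOpens x hxV s').trans ?_
      exact congrArg (X.presheaf.germ (pre F.base V).toOpens x hxV)
        (ConcreteCategory.congr_hom (homSheaf_app F V) s')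
    have h2 : x ∈ X.basicOpen (U := (pre F.base V).toOpens) (F.c.app (op V) s') := by
      refine (X.mem_basicOpen (U := (pre F.base V).toOpens) _ x hxV).mpr ?_
      have ht' : IsUnit (f.stalkMap x (Y.presheaf.germ U (f.base x) hxU s)) := ht
      rw [← hs] at ht'
      exact h1 ▸ ht'
    have h3 := (Y.mem_basicOpen s' _ hxV).mp (mem_basicOpen_of_hom F s' x h2)
    exact hs ▸ h3

lemma quasiCompact_homScheme (F : ofScheme X ⟶ ofScheme Y) : QuasiCompact (homScheme F) :=
  quasiCompact_iff_isSpectralMap.mpr F.base.spectral'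

lemma ofSchemeMap_homScheme (F : ofScheme X ⟶ ofScheme Y) :
    ofSchemeMap (homScheme F) (quasiCompact_homScheme F) = F :=
  AScheme.Hom.ext_heq rfl (heq_of_eq (NatTrans.ext (funext fun V => homSheaf_app F V.unop)))

lemma homScheme_ofSchemeMap (f : X ⟶ Y) (hf : QuasiCompact f) :
    homScheme (ofSchemeMap f hf) = f := by
  have h : homSheaf (ofSchemeMap f hf) = f.c :=
    Functor.IsCoverDense.sheafHom_eq (K := Opens.grothendieckTopology Y) (toOpensFunctor Y)
      (ℱ' := ⟨(TopCat.Presheaf.pushforward _ f.base).obj X.presheaf,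
        TopCat.Sheaf.pushforward_sheaf_of_sheaf f.base X.sheaf.property⟩) f.c
  refine Scheme.Hom.ext' (LocallyRingedSpace.Hom.ext' ?_)
  exact congrArg (PresheafedSpace.Hom.mk f.base) h

end HomScheme

/-- The functor which restricts the structure sheaf of a quasi-compact quasi-separated scheme to its
quasi-compact open sets. -/
noncomputable def schemeFunctor : QSch.{u} ⥤ AScheme.{u} where
  obj X := ofScheme X.toScheme
  map f := ofSchemeMap f.1 f.2
  map_id X := AScheme.Hom.ext_heq rfl (heq_of_eq (NatTrans.ext (funext fun V =>
    Scheme.Hom.id_app (X := X.toScheme) V.unop.toOpens)))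
  map_comp f g := AScheme.Hom.ext_heq rfl (heq_of_eq (NatTrans.ext (funext fun V =>
    Scheme.Hom.comp_app f.1 g.1 V.unop.toOpens)))

instance : schemeFunctor.{u}.Full where
  map_surjective F := ⟨⟨homScheme F, quasiCompact_homScheme F⟩, ofSchemeMap_homScheme F⟩

instance : schemeFunctor.{u}.Faithful where
  map_injective {X Y} f g h := by
    refine Subtype.ext ?_
    rw [← homScheme_ofSchemeMap f.1 f.2, ← homScheme_ofSchemeMap g.1 g.2]
    exact congrArg homScheme h

/-! ### Comparison of the two spectra of a ring -/

section Points
variable {R : Type u} [CommRing R]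

/-- The map from the prime spectrum to the spectrum of the lattice of its quasi-compact open sets,
which sends `p` to the prime ideal of all open sets which do not contain `p`. -/
def toSpecSpace : SpectralMap (PrimeSpectrum R) (SpecSpace R) where
  toFun p := LatSpec.mk' (Order.IsIdeal.toIdeal (I := {K : CompactOpens (PrimeSpectrum R) | p ∉ K})
      { IsLowerSet := fun _ _ h hp h' => hp (h h')
        Nonempty := ⟨⊥, Set.notMem_empty _⟩
        Directed := fun K hK K' hK' =>
          ⟨K ⊔ K', fun h => h.elim hK hK', le_sup_left, le_sup_right⟩ })
    (fun h => h trivial) (fun _ _ h => not_and_or.mp h)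
  spectral' :=
    { toContinuous := LatSpec.isTopologicalBasis.continuous_iff.mpr (by
        rintro _ ⟨K, rfl⟩
        convert! K.isOpen using 1
        exact Set.ext fun p => not_not)
      isCompact_preimage_of_isOpen := fun s hs hs' => by
        obtain ⟨K, rfl⟩ := LatSpec.isCompact_isOpen_iff.mp ⟨hs', hs⟩
        convert! K.isCompact using 1
        exact Set.ext fun p => not_not }

lemma toSpecSpace_mem_basic {p : PrimeSpectrum R} {K : CompactOpens (PrimeSpectrum R)} :
    toSpecSpace p ∈ LatSpec.basic K ↔ p ∈ K := not_not

lemma pt_toSpecSpace (p : PrimeSpectrum R) : pt (toSpecSpace p) = p :=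
  PrimeSpectrum.ext (Ideal.ext fun _ => not_not)

lemma toSpecSpace_pt (x : SpecSpace R) : toSpecSpace (pt x) = x :=
  LatSpec.ext fun _ => not_iff_comm.mp mem_iff_pt_mem

variable (R) in
/-- The map from the spectrum of the lattice `α₁(R)` to the prime spectrum of `R`. -/
def ofSpecSpace : SpectralMap (SpecSpace R) (PrimeSpectrum R) where
  toFun := pt
  spectral' := by
    have h (K : CompactOpens (PrimeSpectrum R)) : pt ⁻¹' (K : Set (PrimeSpectrum R)) =
        LatSpec.basicSet K := Set.ext fun x => mem_iff_pt_mem.symm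
    exact
    { toContinuous := (PrespectralSpace.isTopologicalBasis (X := PrimeSpectrum R)).continuous_iff.mpr
        fun s hs => (h ⟨⟨s, hs.2⟩, hs.1⟩) ▸ LatSpec.isOpen_basicSet _
      isCompact_preimage_of_isOpen := fun s hs hs' =>
        (h ⟨⟨s, hs'⟩, hs⟩) ▸ LatSpec.isCompact_basicSet _ }

end Points

section Sections
variable {R : CommRingCat.{u}}

/-- The canonical map from a ring to the sections of the structure sheaf of its spectrum. -/
noncomputable def toSections (U : (Spec R).Opens) : R →+* Γ(Spec R, U) :=
  @algebraMap R _ _ _ (StructureSheaf.openAlgebra R (op U))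

lemma map_toSections {U V : (Spec R).Opens} (i : V ⟶ U) (a : R) :
    (Spec R).presheaf.map i.op (toSections U a) = toSections V a := rfl

/-- The sections over `D(a)` form the localization of `R` at `a`. -/
lemma isLocalization_toSections (a : R) :
    letI := (toSections (R := R) (PrimeSpectrum.basicOpen a)).toAlgebra
    IsLocalization.Away a Γ(Spec R, PrimeSpectrum.basicOpen a) := by
  have h := StructureSheaf.IsLocalization.to_basicOpen R a
  have e : (toSections (R := R) (PrimeSpectrum.basicOpen a)).toAlgebra =
      StructureSheaf.openAlgebra R (op (PrimeSpectrum.basicOpen a)) :=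
    Algebra.algebra_ext _ _ fun _ => rfl
  rw [e]
  exact h

lemma isUnit_toSections {U : (Spec R).Opens} {a : R} (h : U ≤ PrimeSpectrum.basicOpen a) :
    IsUnit (toSections U a) := by
  let := (toSections (R := R) (PrimeSpectrum.basicOpen a)).toAlgebra
  have := isLocalization_toSections a
  have hu : IsUnit (toSections (PrimeSpectrum.basicOpen a) a) :=
    IsLocalization.Away.algebraMap_isUnit (S := Γ(Spec R, PrimeSpectrum.basicOpen a)) a
  exact hu.map ((Spec R).presheaf.map (homOfLE h).op).hom

lemma basicOpen_toSections (U : (Spec R).Opens) (a : R) :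
    (Spec R).basicOpen (toSections U a) = U ⊓ PrimeSpectrum.basicOpen a := by
  rw [← basicOpen_eq_of_affine a]
  exact (Spec R).basicOpen_res ((Scheme.ΓSpecIso R).inv a) (homOfLE le_top : U ⟶ ⊤).op

lemma app_toSections {S : CommRingCat.{u}} (φ : R ⟶ S) (U : (Spec R).Opens) (a : R) :
    (Spec.map φ).app U (toSections U a) = toSections (Spec.map φ ⁻¹ᵁ U) (φ a) :=
  StructureSheaf.toOpen_comp_comap_apply φ.hom U a

lemma exists_pow_mul_eq_zero {a r : R} (h : toSections (PrimeSpectrum.basicOpen a) r = 0) :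
    ∃ n : ℕ, a ^ n * r = 0 := by
  let := (toSections (R := R) (PrimeSpectrum.basicOpen a)).toAlgebra
  have := isLocalization_toSections a
  obtain ⟨⟨_, n, rfl⟩, hn⟩ := (IsLocalization.map_eq_zero_iff (Submonoid.powers a)
    Γ(Spec R, PrimeSpectrum.basicOpen a) r).mp h
  exact ⟨n, hn⟩

lemma exists_mul_toSections_eq {a : R} (s : Γ(Spec R, PrimeSpectrum.basicOpen a)) :
    ∃ (n : ℕ) (r : R), s * toSections (PrimeSpectrum.basicOpen a) (a ^ n) =
      toSections (PrimeSpectrum.basicOpen a) r := by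
  let := (toSections (R := R) (PrimeSpectrum.basicOpen a)).toAlgebra
  have := isLocalization_toSections a
  obtain ⟨⟨r, ⟨_, n, rfl⟩⟩, h⟩ := IsLocalization.surj (Submonoid.powers a) s
  exact ⟨n, r, h⟩

end Sections

section SpecComparison
variable {R : CommRingCat.{u}}

/-- The inverse image of a quasi-compact open set of `Spec^𝒜 R` in the prime spectrum. -/
def specOpens (Z : CompactOpens (SpecSpace R)) : (Spec R).Opens := (pre toSpecSpace Z).toOpens

lemma mem_specOpens {Z : CompactOpens (SpecSpace R)} {p : Spec R} :
    p ∈ specOpens Z ↔ toSpecSpace p ∈ Z := Iff.rfl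

lemma specOpens_mono {Z W : CompactOpens (SpecSpace R)} (h : W ≤ Z) :
    specOpens W ≤ specOpens Z := fun _ hp => h hp

lemma specOpens_le_basicOpen {Z : CompactOpens (SpecSpace R)} {a : R} (ha : a ∈ mulSys Z) :
    specOpens Z ≤ PrimeSpectrum.basicOpen a :=
  fun _ hp => toSpecSpace_mem_basic.mp (mem_mulSys.mp ha hp)

/-- The sets `D(a)` form a basis of the topology of `Spec^𝒜 R`. -/
lemma exists_basic_alpha2 {Z : CompactOpens (SpecSpace R)} {x : SpecSpace R} (hx : x ∈ Z) :
    ∃ a : R, x ∈ LatSpec.basic (alpha2 a) ∧ LatSpec.basic (alpha2 a) ≤ Z ∧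
      PrimeSpectrum.basicOpen a ≤ specOpens Z := by
  have hp : pt x ∈ specOpens Z := mem_specOpens.mpr ((toSpecSpace_pt x).symm ▸ hx)
  obtain ⟨_, ⟨_, ⟨a, rfl⟩, rfl⟩, hpa, ha⟩ :=
    PrimeSpectrum.isBasis_basic_opens.exists_subset_of_mem_open hp (specOpens Z).isOpen
  exact ⟨a, hpa, fun y hy => toSpecSpace_pt y ▸ mem_specOpens.mp (ha (a := pt y) hy), ha⟩

variable (R) in
/-- The map from the localization `R_Z` to the sections of the structure sheaf over `Z`. -/
noncomputable def locToSections (Z : CompactOpens (SpecSpace R)) :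
    Localization (mulSys Z) →+* Γ(Spec R, specOpens Z) :=
  IsLocalization.lift (M := mulSys Z) (g := toSections (specOpens Z))
    fun a => isUnit_toSections (specOpens_le_basicOpen a.2)

lemma locToSections_algebraMap (Z : CompactOpens (SpecSpace R)) (a : R) :
    locToSections R Z (algebraMap R _ a) = toSections _ a :=
  IsLocalization.lift_eq _ _

lemma locToSections_mk_mul (Z : CompactOpens (SpecSpace R)) (a : R) (b : mulSys Z) :
    locToSections R Z (Localization.mk a b) * toSections _ (b : R) = toSections _ a := by
  rw [← locToSections_algebraMap, ← locToSections_algebraMap, ← map_mul, Localization.mk_eq_mk',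
    IsLocalization.mk'_spec]

/-- A fraction is invertible exactly where its numerator is. -/
lemma mem_basicOpen_locToSections_mk {Z : CompactOpens (SpecSpace R)} (a : R) (b : mulSys Z)
    {p : Spec R} (hp : toSpecSpace p ∈ Z) :
    p ∈ (Spec R).basicOpen (locToSections R Z (Localization.mk a b)) ↔
      toSpecSpace p ∈ LatSpec.basic (alpha2 a) := by
  have h := (Spec R).basicOpen_mul (locToSections R Z (Localization.mk a b))
    (toSections (specOpens Z) (b : R))
  rw [locToSections_mk_mul, basicOpen_toSections, basicOpen_toSections,
    inf_eq_left.mpr (specOpens_le_basicOpen b.2)] at h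
  have h' := SetLike.ext_iff.mp h p
  exact ⟨fun h => toSpecSpace_mem_basic.mpr (h'.mpr ⟨h, hp⟩).2,
    fun h => (h'.mp ⟨hp, toSpecSpace_mem_basic.mp h⟩).1⟩

variable (R)

/-- The structure sheaf of the prime spectrum, on the quasi-compact open sets of `Spec^𝒜 R`. -/
noncomputable abbrev specPresheaf : (CompactOpens (SpecSpace R))ᵒᵖ ⥤ CommRingCat.{u} :=
  (preFunctor (toSpecSpace (R := R))).op ⋙ cptPresheaf (Spec R)

lemma specPresheaf_isSheaf : Presheaf.IsSheaf (cptTopology (SpecSpace R)) (specPresheaf R) :=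
  isSheaf_pushforward (X := PrimeSpectrum R) toSpecSpace (cptPresheaf_isSheaf (Spec R))

/-- The morphism from the presheaf `Z ↦ R_Z` to the structure sheaf of the prime spectrum. -/
noncomputable def preStrToSpec : preStr R ⟶ specPresheaf R where
  app Z := CommRingCat.ofHom (S := Γ(Spec R, specOpens Z.unop)) (locToSections R Z.unop)
  naturality Z W i := by
    ext1
    refine IsLocalization.ringHom_ext (S := Localization (mulSys Z.unop)) (mulSys Z.unop)
      (RingHom.ext fun a => ?_)
    exact (congrArg (locToSections R W.unop) (locMap_algebraMap (mulSys_anti i.unop.le) a)).trans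
      ((locToSections_algebraMap W.unop a).trans
        (congrArg ((specPresheaf R).map i).hom (locToSections_algebraMap Z.unop a)).symm)

/-- The morphism from the structure sheaf of `Spec^𝒜 R` to the one of the prime spectrum. -/
noncomputable def strToSpec : str R ⟶ specPresheaf R :=
  sheafifyLift _ (preStrToSpec R) (specPresheaf_isSheaf R)

lemma toSheafify_strToSpec : toSheafify (cptTopology (SpecSpace R)) (preStr R) ≫ strToSpec R =
    preStrToSpec R :=
  toSheafify_sheafifyLift _ _ _

variable {R}

lemma strToSpec_toStr (Z : CompactOpens (SpecSpace R)) (s : Localization (mulSys Z)) :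
    (strToSpec R).app (op Z) (toStr Z s) = locToSections R Z s :=
  ConcreteCategory.congr_hom (NatTrans.congr_app (toSheafify_strToSpec R) (op Z)) s

/-- An element of `R_Z` which vanishes on the prime spectrum is zero over each set `D(a)` in `Z`: its
numerator is killed by a power of `a`. -/
lemma locMap_eq_zero {Z W : CompactOpens (SpecSpace R)} (h : W ≤ Z) {s : Localization (mulSys Z)}
    (hs : locToSections R Z s = 0) {a : R} (hWa : W = LatSpec.basic (alpha2 a))
    (ha : PrimeSpectrum.basicOpen a ≤ specOpens Z) : locMap (mulSys_anti h) s = 0 := by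
  obtain ⟨⟨r, b⟩, rfl⟩ := Localization.mkHom_surjective (S := mulSys Z) s
  have hr : toSections (specOpens Z) r = 0 := by
    rw [← locToSections_mk_mul Z r b]
    exact (congrArg (· * _) hs).trans (zero_mul _)
  obtain ⟨n, hn⟩ := exists_pow_mul_eq_zero (a := a) (r := r) <| by
    rw [← map_toSections (homOfLE ha), hr, map_zero]
  have haW : a ^ n ∈ mulSys W := pow_mem (mem_mulSys.mpr hWa.le) n
  have h1 := congrArg (algebraMap R (Localization (mulSys W))) hn
  rw [map_mul, map_zero, (IsLocalization.map_units (Localization (mulSys W))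
    (⟨a ^ n, haW⟩ : mulSys W)).mul_right_eq_zero] at h1
  have h2 : locMap (mulSys_anti h) (Localization.mk r b) *
      algebraMap R (Localization (mulSys W)) (b : R) = 0 := by
    rw [← locMap_algebraMap (mulSys_anti h), ← map_mul, Localization.mk_eq_mk',
      IsLocalization.mk'_spec, locMap_algebraMap, h1]
  exact (IsLocalization.map_units (Localization (mulSys W))
    (⟨b, mulSys_anti h b.2⟩ : mulSys W)).mul_left_eq_zero.mp h2

instance isLocallyInjective_preStrToSpec :
    Presheaf.IsLocallyInjective (cptTopology (SpecSpace R)) (preStrToSpec R) where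
  equalizerSieve_mem {Z} (s t : Localization (mulSys Z.unop)) h x hx := by
    obtain ⟨a, hxa, ha, ha'⟩ := exists_basic_alpha2 hx
    refine ⟨_, homOfLE ha, ?_, hxa⟩
    have h0 : locToSections R Z.unop (s - t) = 0 :=
      (map_sub (locToSections R Z.unop) s t).trans (sub_eq_zero.mpr h)
    have h1 := locMap_eq_zero ha h0 rfl ha'
    exact sub_eq_zero.mp ((map_sub (locMap (mulSys_anti ha)) s t).symm.trans h1)

instance isLocallySurjective_preStrToSpec :
    Presheaf.IsLocallySurjective (cptTopology (SpecSpace R)) (preStrToSpec R) where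
  imageSieve_mem {Z} (s : Γ(Spec R, specOpens Z)) x hx := by
    obtain ⟨a, hxa, ha, ha'⟩ := exists_basic_alpha2 hx
    obtain ⟨n, r, hr⟩ := exists_mul_toSections_eq ((Spec R).presheaf.map (homOfLE ha').op s)
    let W := LatSpec.basic (alpha2 a)
    have haW : a ∈ mulSys W := mem_mulSys.mpr le_rfl
    have hs : (Spec R).presheaf.map (homOfLE (specOpens_mono ha)).op s =
        (Spec R).presheaf.map (homOfLE (specOpens_le_basicOpen haW)).op
          ((Spec R).presheaf.map (homOfLE ha').op s) :=
      ConcreteCategory.congr_hom ((Spec R).presheaf.map_comp _ _) s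
    have hr' : (Spec R).presheaf.map (homOfLE (specOpens_mono ha)).op s *
        toSections (specOpens W) (a ^ n) = toSections (specOpens W) r :=
      (congrArg (· * toSections (specOpens W) (a ^ n)) hs).trans ((map_mul ((Spec R).presheaf.map
        (homOfLE (specOpens_le_basicOpen haW)).op).hom _ _).symm.trans (congrArg _ hr))
    refine ⟨W, homOfLE ha, ⟨(Localization.mk r ⟨a ^ n, pow_mem haW n⟩ :
      Localization (mulSys W)), ?_⟩, hxa⟩
    -- Over `D(a)` the section is the fraction `r / a ^ n`.
    have hu : IsUnit (toSections (specOpens W) (a ^ n)) :=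
      isUnit_toSections (specOpens_le_basicOpen (pow_mem haW n))
    exact hu.mul_right_cancel ((locToSections_mk_mul W r ⟨a ^ n, pow_mem haW n⟩).trans hr'.symm)

instance isIso_strToSpec : IsIso (strToSpec R) := by
  have h1 : Presheaf.IsLocallyInjective (cptTopology (SpecSpace R)) (strToSpec R) :=
    Presheaf.isLocallyInjective_of_isLocallyInjective_of_isLocallySurjective_fac _ _
      (toSheafify_strToSpec R)
  have h2 : Presheaf.IsLocallySurjective (cptTopology (SpecSpace R)) (strToSpec R) :=
    Presheaf.isLocallySurjective_of_isLocallySurjective_fac _ (toSheafify_strToSpec R)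
  let f : (⟨str R, str_isSheaf R⟩ : Sheaf (cptTopology (SpecSpace R)) CommRingCat.{u}) ⟶
    ⟨specPresheaf R, specPresheaf_isSheaf R⟩ := ⟨strToSpec R⟩
  have hf : IsIso f := (Sheaf.isLocallyBijective_iff_isIso f).mp ⟨h1, h2⟩
  exact inferInstanceAs (IsIso ((sheafToPresheaf _ _).map f))

/-- A section of the structure sheaf of `Spec^𝒜 R` is invertible at a point if and only if the
corresponding section on the prime spectrum is. -/
lemma mem_basicOpen_strToSpec {Z : CompactOpens (SpecSpace R)} (s : (str R).obj (op Z)) {p : Spec R}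
    (hp : toSpecSpace p ∈ Z) :
    p ∈ (Spec R).basicOpen (U := specOpens Z) ((strToSpec R).app (op Z) s) ↔
      IsUnit (ev (toSpecSpace p) hp s) := by
  obtain ⟨W, i, a, b, hpW, hs⟩ := exists_local s (toSpecSpace p) hp
  rw [← ev_map i _ hpW, hs, ev_toStr _ hpW, isUnit_locMap_mk hpW,
    ← mem_basicOpen_locToSections_mk a b hpW, ← strToSpec_toStr, ← hs]
  have h : (strToSpec R).app (op W) ((str R).map i.op s) =
      (Spec R).presheaf.map (homOfLE (specOpens_mono i.le)).op ((strToSpec R).app (op Z) s) :=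
    NatTrans.naturality_apply (strToSpec R) i.op s
  have h' := (Spec R).basicOpen_res (U := specOpens Z) ((strToSpec R).app (op Z) s)
    (homOfLE (specOpens_mono i.le)).op
  have h'' := congrArg (p ∈ ·)
    ((congrArg (Scheme.basicOpen (Spec R) (U := specOpens W)) h).trans h')
  exact ⟨fun hs => (iff_of_eq h'').mpr ⟨hpW, hs⟩, fun hs => ((iff_of_eq h'').mp hs).2⟩

variable (R)

/-- The comparison morphism from the scheme `Spec R` to `Spec^𝒜 R`. -/
noncomputable def specComparison : ofScheme (Spec R) ⟶ specObj R :=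
  AScheme.Hom.mk (X := ofScheme (Spec R)) (Y := specObj R) toSpecSpace (strToSpec R) <| by
    apply NatTrans.ext
    funext Z
    refine BddDistLat.hom_ext (boundedLatticeHom_ext fun (s : (str R).obj Z) =>
      Subtype.ext (CompactOpens.ext (Set.ext fun (p : Spec R) => ?_)))
    refine (mem_schemeBetaFun_alpha2 (X := Spec R)).trans ?_
    constructor
    · intro h
      have hp : p ∈ specOpens Z.unop := (Spec R).basicOpen_le _ h
      exact ⟨hp, secPt_mem_alpha2.mpr ((mem_basicOpen_strToSpec s hp).mp h)⟩
    · rintro ⟨hp, h⟩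
      exact (mem_basicOpen_strToSpec s hp).mpr (secPt_mem_alpha2.mp h)

end SpecComparison

/-! ### The comparison isomorphism -/

lemma pre_pre_eq {X Y : Type u} [TopologicalSpace X] [TopologicalSpace Y] [QuasiSeparatedSpace X]
    [CompactSpace X] [QuasiSeparatedSpace Y] [CompactSpace Y] {f : SpectralMap X Y}
    {g : SpectralMap Y X} (h : ∀ x, g (f x) = x) (U : CompactOpens X) : pre f (pre g U) = U :=
  CompactOpens.ext (Set.ext fun x => iff_of_eq (congrArg (· ∈ U) (h x)))

namespace AScheme
variable {X Y : AScheme.{u}}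

lemma map_comp_map {U V W : CompactOpens X.carrier} (h : V ≤ U) (h' : W ≤ V) :
    X.presheaf.map (homOfLE h).op ≫ X.presheaf.map (homOfLE h').op =
      X.presheaf.map (homOfLE (h'.trans h)).op :=
  (X.presheaf.map_comp _ _).symm

lemma c_naturality (f : X ⟶ Y) {U V : CompactOpens Y.carrier} (h : V ≤ U) :
    Y.presheaf.map (homOfLE h).op ≫ f.c.app (op V) =
      f.c.app (op U) ≫ X.presheaf.map (homOfLE (OrderHomClass.mono (pre f.base) h)).op :=
  f.c.naturality (homOfLE h).op

/-- The compatibility with `β`, for the generators `D(s)` and in terms of points. -/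
lemma mem_β_c_app (f : X ⟶ Y) {V : CompactOpens Y.carrier} (s : Y.presheaf.obj (op V))
    (x : X.carrier) :
    x ∈ ((X.β.app (op (pre f.base V))).hom (alpha2 (f.c.app (op V) s))).1 ↔
      f.base x ∈ ((Y.β.app (op V)).hom (alpha2 s)).1 := by
  have h := congrArg (fun g => g.hom (alpha2 s)) (NatTrans.congr_app f.comm (op V))
  exact iff_of_eq (congrArg (fun K => x ∈ K.1) h)

lemma mem_β_map {U V : CompactOpens X.carrier} (h : V ≤ U) (s : X.presheaf.obj (op U))
    (x : X.carrier) :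
    x ∈ ((X.β.app (op V)).hom (alpha2 (X.presheaf.map (homOfLE h).op s))).1 ↔
      x ∈ ((X.β.app (op U)).hom (alpha2 s)).1 ∧ x ∈ V := by
  have h := congrArg (fun g => g.hom (alpha2 s)) (X.β.naturality (homOfLE h).op)
  exact iff_of_eq (congrArg (fun K => x ∈ K.1) h)

/-- A morphism of `𝒜`-schemes is an isomorphism if it is a homeomorphism with quasi-compact inverse
on the underlying spaces and an isomorphism on the structure sheaves. -/
lemma isIso_of_inverse (f : X ⟶ Y) (g : SpectralMap Y.carrier X.carrier)
    (hfg : ∀ x, g (f.base x) = x) (hgf : ∀ y, f.base (g y) = y) [IsIso f.c] : IsIso f := by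
  have e (U : CompactOpens X.carrier) : pre f.base (pre g U) = U := pre_pre_eq hfg U
  have e' (V : CompactOpens Y.carrier) : pre g (pre f.base V) = V := pre_pre_eq hgf V
  let d (V : CompactOpens Y.carrier) : X.presheaf.obj (op (pre f.base V)) ⟶ Y.presheaf.obj (op V) :=
    (inv f.c).app (op V)
  have hd (V) : f.c.app (op V) ≫ d V = 𝟙 _ := NatTrans.congr_app (IsIso.hom_inv_id f.c) (op V)
  have hd' (V) : d V ≫ f.c.app (op V) = 𝟙 _ := NatTrans.congr_app (IsIso.inv_hom_id f.c) (op V)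
  have hdn {U V : CompactOpens Y.carrier} (h : V ≤ U) :
      X.presheaf.map (homOfLE (OrderHomClass.mono (pre f.base) h)).op ≫ d V =
        d U ≫ Y.presheaf.map (homOfLE h).op :=
    (inv f.c).naturality (homOfLE h).op
  have hnat {U V : CompactOpens X.carrier} (h : V ≤ U) :
      X.presheaf.map (homOfLE h).op ≫ (X.presheaf.map (homOfLE (e V).le).op ≫ d (pre g V)) =
        (X.presheaf.map (homOfLE (e U).le).op ≫ d (pre g U)) ≫
          Y.presheaf.map (homOfLE (OrderHomClass.mono (pre g) h)).op := by
    rw [Category.assoc, ← hdn, ← Category.assoc, ← Category.assoc, map_comp_map, map_comp_map]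
  -- The inverse of the morphism of sheaves, precomposed with the restriction along the equality
  -- `f⁻¹(g⁻¹(U)) = U`, which does not hold by definition.
  let c' : X.presheaf ⟶ (preFunctor g).op ⋙ Y.presheaf :=
    { app := fun U => X.presheaf.map (homOfLE (e U.unop).le).op ≫ d (pre g U.unop)
      naturality := fun U V i => hnat i.unop.le }
  have hc' (U : CompactOpens X.carrier) : c'.app (op U) ≫ f.c.app (op (pre g U)) =
      X.presheaf.map (homOfLE (e U).le).op :=
    (Category.assoc _ _ _).trans ((congrArg (_ ≫ ·) (hd' _)).trans (Category.comp_id _))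
  have hc (V : CompactOpens Y.carrier) : f.c.app (op V) ≫ c'.app (op (pre f.base V)) =
      Y.presheaf.map (homOfLE (e' V).le).op := by
    have h := (Category.assoc _ _ _).symm.trans
      ((congrArg (· ≫ d _) (c_naturality f (e' V).le)).symm.trans (Category.assoc _ _ _))
    exact h.trans ((congrArg (_ ≫ ·) (hd _)).trans (Category.comp_id _))
  let f' : Y ⟶ X := AScheme.Hom.mk (X := Y) (Y := X) g c' <| by
    apply NatTrans.ext
    funext U
    refine BddDistLat.hom_ext (boundedLatticeHom_ext fun (s : X.presheaf.obj U) =>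
      Subtype.ext (CompactOpens.ext (Set.ext fun (y : Y.carrier) => ?_)))
    let t : Y.presheaf.obj (op (pre g U.unop)) := c'.app U s
    have ht : f.c.app (op (pre g U.unop)) t = X.presheaf.map (homOfLE (e U.unop).le).op s :=
      ConcreteCategory.congr_hom (hc' U.unop) s
    -- The condition for `f` at the point `g y` and the section `t` is the one for the inverse at `y`.
    have h1 := mem_β_c_app f t (g y)
    rw [ht, hgf, mem_β_map] at h1
    refine h1.symm.trans ⟨fun h => h.1, fun h => ⟨h, ?_⟩⟩
    rw [e]
    exact (Set.mem_Iic.mp ((X.β.app U).hom (alpha2 s)).2) h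
  refine ⟨f', AScheme.hom_ext_app (SpectralMap.ext hfg) fun U h => ?_,
    AScheme.hom_ext_app (SpectralMap.ext hgf) fun V h => ?_⟩
  · exact (hc' U).trans (Category.id_comp _).symm
  · exact (hc V).trans (Category.id_comp _).symm

end AScheme

instance isIso_specComparison (R : CommRingCat.{u}) : IsIso (specComparison R) :=
  have : IsIso (specComparison R).c := isIso_strToSpec
  AScheme.isIso_of_inverse (specComparison R) (ofSpecSpace R) pt_toSpecSpace toSpecSpace_pt

/-- The comparison isomorphisms between the two spectra of a ring, as an isomorphism of functors. -/
noncomputable def specIso : SpecQ.{u} ⋙ schemeFunctor ≅ SpecA :=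
  NatIso.ofComponents (fun R => @asIso _ _ _ _ _ (isIso_specComparison R.unop)) fun {R S} φ =>
    -- On the section given by `a`, both composites are the section given by the image of `a`.
    hom_specObj_ext rfl fun Z a h => by
      let V := specOpens Z
      have h1 : (Spec.map φ.unop).app V ((strToSpec S.unop).app (op Z) (toStr Z (algebraMap _ _ a)))
          = toSections (Spec.map φ.unop ⁻¹ᵁ V) (φ.unop a) :=
        (congrArg ((Spec.map φ.unop).app V)
          ((strToSpec_toStr Z _).trans (locToSections_algebraMap Z a))).trans (app_toSections _ _ _)
      let Z' := pre (specBase φ.unop.hom) Z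
      have h2 : (strToSpec R.unop).app (op Z')
          ((strMap φ.unop.hom).app (op Z) (toStr Z (algebraMap _ _ a))) =
            toSections (specOpens Z') (φ.unop a) :=
        (congrArg ((strToSpec R.unop).app (op Z')) ((strMap_toStr φ.unop.hom Z _).trans
          (congrArg (toStr Z') (locMapAlong_algebraMap φ.unop.hom _ a)))).trans
            ((strToSpec_toStr Z' _).trans (locToSections_algebraMap Z' _))
      refine h1.trans (Eq.symm ?_)
      exact congrArg ((cptPresheaf (Spec R.unop)).map (homOfLE h).op) h2

end ASch

theorem mainTheorem2 : ∃ I : ASch.QSch.{u} ⥤ ASch.AScheme.{u},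
    I.Full ∧ I.Faithful ∧ Nonempty (ASch.SpecQ ⋙ I ≅ ASch.SpecA) := by
  exact ⟨ASch.schemeFunctor, inferInstance, inferInstance, ⟨ASch.specIso⟩⟩
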